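/- Let $d\ge 1$ and let $f\in\mathbb{R}[x,y,z]$ be homogeneous of degree $d$ and hyperbolic with respect to $e\in\mathbb{R}^3$, that is, $f(e)\neq 0$ and for every $v\in\mathbb{R}^3$ the univariate polynomial $f(te+v)\in\mathbb{R}[t]$ has only real zeros. Assume that the complex projective plane curve $\mathcal{V}_{\mathbb{C}}(f)\subseteq\mathbb{P}^2$ is smooth, that is, $\nabla f(p)\neq 0$ for every $p\in\mathbb{C}^3\setminus\{0\}$ with $f(p)=0$. For univariate real polynomials $p,q$ with only real zeros and $\deg q=\deg p-1$, let $\alpha_1\le\dots\le\alpha_m$ be the zeros of $p$ and $\beta_1\le\dots\le\beta_{m-1}$ the zeros of $q$, listed with multiplicity; $q$ *interlaces* $p$ if $\alpha_i\le\beta_i\le\alpha_{i+1}$ for $i=1,\dots,m-1$. The cone of interlacers of $f$ is $$\mathrm{Int}(f,e)=\{g\in\mathbb{R}[x,y,z]_{d-1} : g(e)>0 \text{ and } g(te+v)\text{ interlaces } f(te+v)\text{ for every } v\in\mathbb{R}^3\},$$ and an *extremal interlacer* of $f$ is a form $g\in\mathrm{Int}(f,e)$ that spans an extreme ray of this cone.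 A *real contact point* of $g$ with $f$ is a point $p\in\mathbb{P}^2(\mathbb{R})$ with $f(p)=g(p)=0$ at which the intersection multiplicity $\mathrm{mult}_p(f,g)$ is even; in counting real contact points with multiplicity, $p$ is counted $\frac12\mathrm{mult}_p(f,g)$ times. Then every extremal interlacer $g$ of $f$ has only finitely many real contact points with $f$, and their number, counted with multiplicity, satisfies $$\sum_{p}\tfrac12\,\mathrm{mult}_p(f,g)\ \ge\ \left\lceil\frac{(d+1)d-2}{4}\right\rceil ,$$ where $p$ runs over the real contact points of $g$ with $f$. -/

import Mathlib

open MvPolynomial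

noncomputable section

/-- The restriction `f(t e + v)` of a ternary polynomial to a line, as a polynomial in `t`. -/
def restrictLine (f : MvPolynomial (Fin 3) ℝ) (e v : Fin 3 → ℝ) : Polynomial ℝ :=
  aeval (fun i => Polynomial.C (e i) * Polynomial.X + Polynomial.C (v i)) f

/-- `f` is hyperbolic with respect to `e`: `f(e) ≠ 0`, and `f(t e + v)` has only real zeros
for every real vector `v`. -/
def IsHyperbolic (f : MvPolynomial (Fin 3) ℝ) (e : Fin 3 → ℝ) : Prop :=
  eval e f ≠ 0 ∧ ∀ v : Fin 3 → ℝ, (restrictLine f e v).Splits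

/-- The complex projective plane curve defined by the real form `f` is smooth. -/
def IsSmoothCurve (f : MvPolynomial (Fin 3) ℝ) : Prop :=
  ∀ v : Fin 3 → ℂ, v ≠ 0 → aeval v f = 0 → ∃ i, aeval v (pderiv i f) ≠ 0

/-- The univariate polynomial `q` interlaces `p`: both are nonzero with only real zeros,
`deg q = deg p - 1`, and the ordered zeros `α` of `p` and `β` of `q` (listed with multiplicity)
satisfy `α i ≤ β i ≤ α (i + 1)` for all `i`. -/
def Interlaces (q p : Polynomial ℝ) : Prop :=
  p ≠ 0 ∧ q ≠ 0 ∧ ∃ (n : ℕ) (α : Fin (n + 1) → ℝ) (β : Fin n → ℝ),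
    Monotone α ∧ Monotone β ∧
    p = Polynomial.C p.leadingCoeff * ∏ i, (Polynomial.X - Polynomial.C (α i)) ∧
    q = Polynomial.C q.leadingCoeff * ∏ i, (Polynomial.X - Polynomial.C (β i)) ∧
    ∀ i : Fin n, α i.castSucc ≤ β i ∧ β i ≤ α i.succ

/-- The cone `Int(f, e)` of interlacers of a form `f` of degree `d`: forms `g` of degree `d - 1`
with `g(e) > 0` such that `g(t e + v)` interlaces `f(t e + v)` for every real vector `v`. -/
def interlacerCone (d : ℕ) (f : MvPolynomial (Fin 3) ℝ) (e : Fin 3 → ℝ) :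
    Set (MvPolynomial (Fin 3) ℝ) :=
  {g | g.IsHomogeneous (d - 1) ∧
    (∀ v : Fin 3 → ℝ, Interlaces (restrictLine g e v) (restrictLine f e v)) ∧ 0 < eval e g}

/-- `g` is an extremal interlacer of `f`: it lies in `Int(f, e)` and the open ray that it spans is
an extreme subset of `Int(f, e)` (the origin does not belong to `Int(f, e)`). -/
def IsExtremalInterlacer (d : ℕ) (f : MvPolynomial (Fin 3) ℝ) (e : Fin 3 → ℝ)
    (g : MvPolynomial (Fin 3) ℝ) : Prop :=
  g ∈ interlacerCone d f e ∧
    IsExtreme ℝ (interlacerCone d f e) {h | ∃ c : ℝ, 0 < c ∧ h = c • g}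

section Multiplicity

variable {K : Type*} [Field K]

/-- Dehomogenization: set the `i`-th variable equal to `1`. -/
def dehomogenize (i : Fin 3) (f : MvPolynomial (Fin 3) K) : MvPolynomial (Fin 2) K :=
  aeval (i.insertNth (1 : MvPolynomial (Fin 2) K) (X : Fin 2 → MvPolynomial (Fin 2) K) :
    Fin 3 → MvPolynomial (Fin 2) K) f

/-- The maximal ideal of polynomials vanishing at the point `a` of the affine plane. -/
def pointIdeal (a : Fin 2 → K) : Ideal (MvPolynomial (Fin 2) K) :=
  RingHom.ker (eval a : MvPolynomial (Fin 2) K →+* K)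

instance (a : Fin 2 → K) : (pointIdeal a).IsPrime :=
  RingHom.ker_isPrime (eval a : MvPolynomial (Fin 2) K →+* K)

/-- The intersection multiplicity of two affine plane curves at a `K`-rational point `a`:
`dim_K 𝒪_a / (f, g)`, with `𝒪_a` the local ring of the affine plane at `a`. -/
def affineIntersectionMultiplicity (f g : MvPolynomial (Fin 2) K) (a : Fin 2 → K) : ℕ :=
  Module.finrank K
    (Localization.AtPrime (pointIdeal a) ⧸
      (Ideal.span {f, g}).map
        (algebraMap (MvPolynomial (Fin 2) K) (Localization.AtPrime (pointIdeal a))))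

theorem exists_rep_apply_ne_zero (p : Projectivization K (Fin 3 → K)) : ∃ i, p.rep i ≠ 0 :=
  Function.ne_iff.mp p.rep_nonzero

/-- The index of some standard affine chart of the projective plane containing `p`. -/
def chartIndex (p : Projectivization K (Fin 3 → K)) : Fin 3 :=
  (exists_rep_apply_ne_zero p).choose

/-- The intersection multiplicity `mult_p(f, g)` of two plane projective curves at a `K`-rational
point `p`, computed in a standard affine chart containing `p`. (Since the dimension of the local
algebra is unchanged by extension of the base field, for real `f`, `g`, `p` this is also the
intersection multiplicity of the complex curves at `p`.) -/
def intersectionMultiplicity (f g : MvPolynomial (Fin 3) K)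
    (p : Projectivization K (Fin 3 → K)) : ℕ :=
  affineIntersectionMultiplicity (dehomogenize (chartIndex p) f) (dehomogenize (chartIndex p) g)
    (fun j => p.rep ((chartIndex p).succAbove j) / p.rep (chartIndex p))

end Multiplicity

/-- The real contact points of `g` with `f`: the real points of the projective plane on both
curves at which the intersection multiplicity is even. -/
def realContactPoints (f g : MvPolynomial (Fin 3) ℝ) : Set (Projectivization ℝ (Fin 3 → ℝ)) :=
  {p | eval p.rep f = 0 ∧ eval p.rep g = 0 ∧ Even (intersectionMultiplicity f g p)}

/-- The number of real contact points counted with multiplicity: a contact point with intersection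
multiplicity `2 m` is counted `m` times. -/
def realContactCount (f g : MvPolynomial (Fin 3) ℝ) : ℕ :=
  ∑ᶠ p ∈ realContactPoints f g, intersectionMultiplicity f g p / 2

end

noncomputable section

/-! ### Homogeneous polynomials along lines -/

/-! The interlacing condition is a sign condition on the real curve. Smoothness and hyperbolicity
make the derivative `D_e f` nonzero at every real point of the curve
(`dirDeriv_ne_zero_of_isSmoothCurve`), and a form `g` of degree `d - 1` with `g(e) > 0` interlaces
`f` exactly when `f(e) · D_e f · g ≥ 0` on the real zeros of `f` (`interlacerCone_nonneg`,
`mem_interlacerCone_of_nonneg`).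

Two consequences follow. Since `g` does not change sign along the curve near a real common zero,
every real intersection has even multiplicity, so all real common zeros are contact points
(`realContactPoints_eq`). They are finite in number because `f` is irreducible and `deg g < deg f`.
Moreover, if `h` has degree `d - 1` and lies in the ideal `(f, g)` locally at each real common zero,
compactness gives `|h| ≤ C |g|` on the real curve. Then `g ± εh` are interlacers for small `ε`, and
extremality of `g` forces `h` to be a multiple of `g` (`IsExtremalInterlacer.eq_smul`).

Hence the map from forms of degree `d - 1` to the product of the local algebras at the contact
points has kernel of dimension at most one. The domain has dimension at least `d(d+1)/2`, and the
target has dimension the sum of the multiplicities, which is twice the contact count `N`. So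
`d(d+1)/2 - 1 ≤ 2N`, which is the bound.

The local input is that, modulo `f`, the local ring at a regular point has principal maximal ideal.
There `g` is a unit times `t^m`, and the same `m` is both the multiplicity and the order governing
sign changes (`intersection_at_regular_point`). -/

theorem aeval_smul_of_isHomogeneous {σ R A : Type*} [CommSemiring R] [CommSemiring A]
    [Algebra R A] {f : MvPolynomial σ R} {d : ℕ} (hf : f.IsHomogeneous d) (c : A) (x : σ → A) :
    aeval (c • x) f = c ^ d * aeval x f := by
  rw [aeval_def, aeval_def, eval₂_eq, eval₂_eq, Finset.mul_sum]
  refine Finset.sum_congr rfl fun m hm => ?_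
  have hd := hf.degree_eq_sum_deg_support hm
  rw [hd, ← Finset.prod_pow_eq_pow_sum]
  simp only [Pi.smul_apply, smul_eq_mul, mul_pow, Finset.prod_mul_distrib]
  ring

theorem eval_smul_of_isHomogeneous {σ R : Type*} [CommSemiring R]
    {f : MvPolynomial σ R} {d : ℕ} (hf : f.IsHomogeneous d) (c : R) (x : σ → R) :
    eval (c • x) f = c ^ d * eval x f := by
  simpa only [aeval_eq_eval] using aeval_smul_of_isHomogeneous hf c x

theorem eval_aeval_line {σ : Type*} (f : MvPolynomial σ ℝ) (e v : σ → ℝ) (t : ℝ) :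
    (aeval (fun i => Polynomial.C (e i) * Polynomial.X + Polynomial.C (v i)) f).eval t =
      eval (t • e + v) f := by
  induction f using MvPolynomial.induction_on with
  | C a => simp [algHom_C]
  | add p q hp hq => simp [hp, hq]
  | mul_X p i hp => simp [hp, mul_comm t]

theorem eval_restrictLine (f : MvPolynomial (Fin 3) ℝ) (e v : Fin 3 → ℝ) (t : ℝ) :
    (restrictLine f e v).eval t = eval (t • e + v) f :=
  eval_aeval_line f e v t

/-- The derivative of a polynomial in the direction `e`. -/
def dirDeriv {σ : Type*} [Fintype σ] (e : σ → ℝ) (f : MvPolynomial σ ℝ) : MvPolynomial σ ℝ :=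
  ∑ i, C (e i) * pderiv i f

theorem eval_dirDeriv {σ : Type*} [Fintype σ] (e x : σ → ℝ) (f : MvPolynomial σ ℝ) :
    eval x (dirDeriv e f) = ∑ i, e i * eval x (pderiv i f) := by
  simp [dirDeriv]

theorem derivative_aeval_line {σ : Type*} [Fintype σ] [DecidableEq σ] (f : MvPolynomial σ ℝ)
    (e v : σ → ℝ) :
    Polynomial.derivative
        (aeval (fun i => Polynomial.C (e i) * Polynomial.X + Polynomial.C (v i)) f) =
      aeval (fun i => Polynomial.C (e i) * Polynomial.X + Polynomial.C (v i)) (dirDeriv e f) := by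
  induction f using MvPolynomial.induction_on with
  | C a => simp [dirDeriv]
  | add p q hp hq => simp only [dirDeriv, map_add, hp, hq, mul_add, Finset.sum_add_distrib]
  | mul_X p i hp =>
    have h1 : dirDeriv e (p * X i) = dirDeriv e p * X i + C (e i) * p := by
      simp only [dirDeriv, pderiv_mul, pderiv_X, mul_add, Finset.sum_add_distrib, Finset.sum_mul,
        mul_assoc]
      congr 1
      rw [Finset.sum_eq_single i]
      · simp
      · intro j _ hj; simp [Pi.single_eq_of_ne' hj]
      · simp
    rw [h1, map_mul, Polynomial.derivative_mul, hp, map_add, map_mul, map_mul, aeval_X, algHom_C,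
      ← Polynomial.C_eq_algebraMap, Polynomial.derivative_add, Polynomial.derivative_C_mul,
      Polynomial.derivative_X, Polynomial.derivative_C, mul_one, add_zero]
    ring

theorem derivative_restrictLine (f : MvPolynomial (Fin 3) ℝ) (e v : Fin 3 → ℝ) :
    Polynomial.derivative (restrictLine f e v) = restrictLine (dirDeriv e f) e v :=
  derivative_aeval_line f e v

theorem natDegree_restrictLine_le {f : MvPolynomial (Fin 3) ℝ} {d : ℕ} (hf : f.IsHomogeneous d)
    (e v : Fin 3 → ℝ) : (restrictLine f e v).natDegree ≤ d := by
  have := aeval_natDegree_le (m := d) (n := 1) f hf.totalDegree_le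
    (fun i => Polynomial.C (e i) * Polynomial.X + Polynomial.C (v i))
    (fun i => Polynomial.natDegree_linear_le)
  simpa [restrictLine] using this

theorem coeff_restrictLine {f : MvPolynomial (Fin 3) ℝ} {d : ℕ} (hf : f.IsHomogeneous d)
    (e v : Fin 3 → ℝ) : (restrictLine f e v).coeff d = eval e f := by
  rw [restrictLine, aeval_def, eval₂_eq, Polynomial.finsetSum_coeff, eval_eq]
  refine Finset.sum_congr rfl fun m hm => ?_
  have hd : d = m 0 + m 1 + m 2 := by
    have := hf.degree_eq_sum_deg_support hm
    rw [this, Finset.sum_subset (Finset.subset_univ _), Fin.sum_univ_three]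
    simp
  rw [← Polynomial.C_eq_algebraMap, Polynomial.coeff_C_mul]
  congr 1
  have hl (i : Fin 3) (k : ℕ) :
      ((Polynomial.C (e i) * Polynomial.X + Polynomial.C (v i)) ^ k).natDegree ≤ k := by
    simpa using Polynomial.natDegree_pow_le_of_le k
      (Polynomial.natDegree_linear_le (a := e i) (b := v i))
  have hc (i : Fin 3) (k : ℕ) :
      ((Polynomial.C (e i) * Polynomial.X + Polynomial.C (v i)) ^ k).coeff k = e i ^ k := by
    have := Polynomial.coeff_pow_of_natDegree_le (m := k)
      (Polynomial.natDegree_linear_le (a := e i) (b := v i))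
    rw [mul_one] at this
    simp [this, Polynomial.coeff_C]
  have hs : (∏ i ∈ m.support, (Polynomial.C (e i) * Polynomial.X + Polynomial.C (v i)) ^ m i) =
      ∏ i : Fin 3, (Polynomial.C (e i) * Polynomial.X + Polynomial.C (v i)) ^ m i :=
    Finset.prod_subset (Finset.subset_univ _) (by simp +contextual)
  have hs' : (∏ i ∈ m.support, e i ^ m i) = ∏ i : Fin 3, e i ^ m i :=
    Finset.prod_subset (Finset.subset_univ _) (by simp +contextual)
  rw [hs, hs', Fin.prod_univ_three, Fin.prod_univ_three, hd,
    Polynomial.coeff_mul_add_eq_of_natDegree_le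
      (Polynomial.natDegree_mul_le_of_le (hl 0 _) (hl 1 _)) (hl 2 _),
    Polynomial.coeff_mul_add_eq_of_natDegree_le (hl 0 _) (hl 1 _), hc, hc, hc]

theorem natDegree_restrictLine {f : MvPolynomial (Fin 3) ℝ} {d : ℕ} (hf : f.IsHomogeneous d)
    {e : Fin 3 → ℝ} (he : eval e f ≠ 0) (v : Fin 3 → ℝ) : (restrictLine f e v).natDegree = d :=
  le_antisymm (natDegree_restrictLine_le hf e v)
    (Polynomial.le_natDegree_of_ne_zero (by rwa [coeff_restrictLine hf]))

theorem leadingCoeff_restrictLine {f : MvPolynomial (Fin 3) ℝ} {d : ℕ} (hf : f.IsHomogeneous d)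
    {e : Fin 3 → ℝ} (he : eval e f ≠ 0) (v : Fin 3 → ℝ) :
    (restrictLine f e v).leadingCoeff = eval e f := by
  rw [Polynomial.leadingCoeff, natDegree_restrictLine hf he, coeff_restrictLine hf]

/-! ### Real-rooted univariate polynomials -/

/-- This is `-(log Q)'' = ∑ 1/(x - a)²` at `x = 0`, with denominators cleared. It controls the
distance of the roots from `0` by the values of `Q`, `Q'`, `Q''` at `0`. -/
theorem derivative_sq_sub_prod_X_sub_C (s : Multiset ℝ) (hs : ∀ a ∈ s, a ≠ 0) :
    let Q := (s.map fun a => Polynomial.X - Polynomial.C a).prod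
    Q.derivative.eval 0 ^ 2 - Q.eval 0 * Q.derivative.derivative.eval 0 =
      Q.eval 0 ^ 2 * (s.map fun a => a⁻¹ ^ 2).sum := by
  induction s using Multiset.induction_on with
  | empty => simp
  | cons a s ih =>
    have ha : a ≠ 0 := hs a (Multiset.mem_cons_self a s)
    have ih' := ih fun b hb => hs b (Multiset.mem_cons_of_mem hb)
    simp only [Multiset.map_cons, Multiset.prod_cons, Multiset.sum_cons] at ih' ⊢
    set R := (s.map fun a => Polynomial.X - Polynomial.C a).prod
    simp only [Polynomial.derivative_mul, Polynomial.derivative_sub, Polynomial.derivative_X,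
      Polynomial.derivative_C, Polynomial.eval_mul, Polynomial.eval_add, Polynomial.eval_sub,
      Polynomial.eval_X, Polynomial.eval_C, Polynomial.derivative_add, sub_zero, one_mul,
      zero_sub]
    have : (-a * R.eval 0) ^ 2 * (a⁻¹ ^ 2 + (s.map fun a => a⁻¹ ^ 2).sum) =
        R.eval 0 ^ 2 + a ^ 2 * (R.eval 0 ^ 2 * (s.map fun a => a⁻¹ ^ 2).sum) := by
      field_simp
    rw [this, ← ih']
    ring

theorem abs_eval_prod_X_sub_C_le (s : Multiset ℝ) {M : ℝ} (hM : 0 ≤ M)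
    (hs : ∀ a ∈ s, 1 ≤ M * |a|) (t : ℝ) :
    |((s.map fun a => Polynomial.X - Polynomial.C a).prod).eval t| ≤
      |((s.map fun a => Polynomial.X - Polynomial.C a).prod).eval 0| * (1 + M * |t|) ^ s.card := by
  induction s using Multiset.induction_on with
  | empty => simp
  | cons a s ih =>
    have ha := hs a (Multiset.mem_cons_self a s)
    have ih' := ih fun b hb => hs b (Multiset.mem_cons_of_mem hb)
    simp only [Multiset.map_cons, Multiset.prod_cons, Polynomial.eval_mul, abs_mul,
      Multiset.card_cons, pow_succ, Polynomial.eval_sub, Polynomial.eval_X, Polynomial.eval_C,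
      zero_sub, abs_neg]
    have h1 : |t - a| ≤ |a| * (1 + M * |t|) := by
      calc |t - a| ≤ |t| + |a| := abs_sub _ _
        _ ≤ |a| * (1 + M * |t|) := by nlinarith [abs_nonneg t]
    calc _ ≤ (|a| * (1 + M * |t|)) * (_ * (1 + M * |t|) ^ s.card) :=
          mul_le_mul h1 ih' (abs_nonneg _) (by positivity)
      _ = _ := by ring

/-- A real-rooted polynomial whose logarithmic derivative at `0` has bounded slope grows at a
controlled rate. -/
theorem Polynomial.Splits.abs_eval_le {P : Polynomial ℝ} (hP : P.Splits) (h0 : P.eval 0 ≠ 0)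
    {M : ℝ} (hM : 0 ≤ M)
    (h : (P.derivative.eval 0 / P.eval 0) ^ 2 - P.derivative.derivative.eval 0 / P.eval 0 ≤ M ^ 2)
    (t : ℝ) : |P.eval t| ≤ |P.eval 0| * (1 + M * |t|) ^ P.natDegree := by
  have hroots : ∀ a ∈ P.roots, a ≠ 0 := by
    rintro a ha rfl
    exact h0 (Polynomial.isRoot_of_mem_roots ha)
  have hkey := derivative_sq_sub_prod_X_sub_C P.roots hroots
  have hle := fun hs => abs_eval_prod_X_sub_C_le P.roots hM hs t
  have hEq := hP.eq_prod_roots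
  rw [hP.natDegree_eq_card_roots]
  set Q := (P.roots.map fun a => Polynomial.X - Polynomial.C a).prod
  set c := P.leadingCoeff
  have e0 (t : ℝ) : P.eval t = c * Q.eval t := by rw [hEq]; simp
  have e1 : P.derivative.eval 0 = c * Q.derivative.eval 0 := by rw [hEq]; simp
  have e2 : P.derivative.derivative.eval 0 = c * Q.derivative.derivative.eval 0 := by
    rw [hEq]; simp
  have hc : c ≠ 0 := fun hc => h0 (by rw [e0, hc, zero_mul])
  have hQ : Q.eval 0 ≠ 0 := fun hc => h0 (by rw [e0, hc, mul_zero])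
  have hsum : (P.roots.map fun a => a⁻¹ ^ 2).sum ≤ M ^ 2 := by
    refine le_trans (le_of_eq ?_) h
    rw [e0, e1, e2, mul_div_mul_left _ _ hc, mul_div_mul_left _ _ hc]
    simp only at hkey
    rw [div_pow, div_sub_div _ _ (pow_ne_zero 2 hQ) hQ, eq_comm,
      div_eq_iff (mul_ne_zero (pow_ne_zero 2 hQ) hQ)]
    linear_combination (Q.eval 0) * hkey
  -- A single term `1/a²` is at most the whole sum, hence at most `M²`, so no root is closer to `0`
  -- than `1/M`.
  have hs : ∀ a ∈ P.roots, 1 ≤ M * |a| := by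
    intro a ha
    have h1 : a⁻¹ ^ 2 ≤ (P.roots.map fun a => a⁻¹ ^ 2).sum :=
      Multiset.single_le_sum (by
        intro x hx
        obtain ⟨b, -, rfl⟩ := Multiset.mem_map.1 hx
        positivity) _ (Multiset.mem_map_of_mem _ ha)
    have h2 : |a⁻¹| ≤ M := abs_le_of_sq_le_sq (h1.trans hsum) hM
    have h3 : 0 < |a| := abs_pos.2 (hroots a ha)
    rw [abs_inv] at h2
    calc (1 : ℝ) = |a|⁻¹ * |a| := (inv_mul_cancel₀ h3.ne').symm
      _ ≤ _ := by gcongr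
  rw [e0, e0, abs_mul, abs_mul, mul_assoc]
  exact mul_le_mul_of_nonneg_left (hle hs) (abs_nonneg c)

/-- Used with `a = F₁(s)`, `b = F₁(0)` and `s = σ * r`: for `s` near `0` on the side chosen by `σ`,
the singular term `H(0) / (s F₁(s))` is nonnegative. -/
theorem div_nonneg_of_sign_eq {h σ r a b : ℝ} (hσ0 : σ ≠ 0) (hr : 0 < r) (hab : 0 < a * b)
    (hb : 0 ≤ h * σ * b) : 0 ≤ h / (σ * r * a) := by
  have hb0 : b ≠ 0 := right_ne_zero_of_mul hab.ne'
  have ha0 : a ≠ 0 := left_ne_zero_of_mul hab.ne'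
  have h1 : h / (σ * r * a) = (h * σ * b) * (a * b) * r / (σ * r * a * b) ^ 2 := by
    field_simp
  rw [h1]
  exact div_nonneg (mul_nonneg (mul_nonneg hb hab.le) hr.le) (sq_nonneg _)

open Filter Topology in
/-- At a regular real point of a hyperbolic curve, the hyperbolicity direction is transversal to
the curve. -/
theorem IsHyperbolic.eval_dirDeriv_ne_zero {f : MvPolynomial (Fin 3) ℝ} {d : ℕ}
    (hf : f.IsHomogeneous d) {e : Fin 3 → ℝ} (hyp : IsHyperbolic f e) {p w : Fin 3 → ℝ}
    (hp : eval p f = 0) (hw : eval p (dirDeriv w f) ≠ 0) : eval p (dirDeriv e f) ≠ 0 := by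
  -- If `D_e f` vanished at `p`, consider `P_s(t) = f(te + sw + p)`. Then `P_s(0) = s F₁(s)` and
  -- `P_s'(0) = s G₁(s)`. For `s` of a suitable sign the sum of inverse squares of the roots stays
  -- bounded, so `P_s` is bounded by a multiple of `P_s(0)`, which tends to `0`. Then `P_0` is the
  -- zero polynomial, against `f(e) ≠ 0`.
  intro hG0
  have hF0 : (restrictLine f w p).eval 0 = 0 := by simp [eval_restrictLine, hp]
  have hG0' : (restrictLine (dirDeriv e f) w p).eval 0 = 0 := by simp [eval_restrictLine, hG0]
  obtain ⟨F₁, hF₁⟩ := Polynomial.X_dvd_iff.2 (by rwa [Polynomial.coeff_zero_eq_eval_zero] :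
    (restrictLine f w p).coeff 0 = 0)
  obtain ⟨G₁, hG₁⟩ := Polynomial.X_dvd_iff.2 (by rwa [Polynomial.coeff_zero_eq_eval_zero] :
    (restrictLine (dirDeriv e f) w p).coeff 0 = 0)
  set H := restrictLine (dirDeriv e (dirDeriv e f)) w p with hH
  obtain ⟨H₁, hH₁⟩ : Polynomial.X ∣ H - Polynomial.C (H.eval 0) :=
    Polynomial.X_dvd_iff.2 (by simp [Polynomial.coeff_zero_eq_eval_zero])
  have hF₁0 : F₁.eval 0 ≠ 0 := by
    have := congrArg (fun q => (Polynomial.derivative q).eval 0) hF₁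
    simp only [derivative_restrictLine, eval_restrictLine, zero_smul, zero_add,
      Polynomial.derivative_mul, Polynomial.derivative_X, one_mul, Polynomial.eval_add,
      Polynomial.eval_mul, Polynomial.eval_X, zero_mul, add_zero] at this
    rwa [← this]
  have eF (s : ℝ) : (restrictLine f e (s • w + p)).eval 0 = s * F₁.eval s := by
    rw [eval_restrictLine, zero_smul, zero_add, ← eval_restrictLine, hF₁]; simp
  have eG (s : ℝ) : (restrictLine f e (s • w + p)).derivative.eval 0 = s * G₁.eval s := by
    rw [derivative_restrictLine, eval_restrictLine, zero_smul, zero_add, ← eval_restrictLine, hG₁]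
    simp
  have eH (s : ℝ) : (restrictLine f e (s • w + p)).derivative.derivative.eval 0 =
      H.eval 0 + s * H₁.eval s := by
    rw [derivative_restrictLine, derivative_restrictLine, eval_restrictLine, zero_smul, zero_add,
      ← eval_restrictLine, ← hH, sub_eq_iff_eq_add.1 hH₁]
    simp [add_comm]
  obtain ⟨σ, hσ, hσs⟩ : ∃ σ : ℝ, σ ^ 2 = 1 ∧ 0 ≤ H.eval 0 * σ * F₁.eval 0 := by
    rcases le_total 0 (H.eval 0 * F₁.eval 0) with h | h
    · exact ⟨1, by norm_num, by linarith⟩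
    · exact ⟨-1, by norm_num, by linarith⟩
  -- The value at `s = 0` of the part of the sum that stays finite, plus slack `1`. The remaining
  -- term `-H(0)/(s F₁(s))` is nonpositive by the choice of `σ` and can be dropped.
  set B := (G₁.eval 0 / F₁.eval 0) ^ 2 - H₁.eval 0 / F₁.eval 0 + 1 with hB
  set M := √(max B 0) with hM
  have hMB : B ≤ M ^ 2 := by
    rw [hM, Real.sq_sqrt (le_max_right _ _)]; exact le_max_left _ _
  have hσt : Tendsto (fun r : ℝ => σ * r) (𝓝[>] 0) (𝓝 0) := by
    have : Continuous fun r : ℝ => σ * r := by fun_prop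
    simpa using (this.tendsto 0).mono_left nhdsWithin_le_nhds
  have hev1 : ∀ᶠ s in 𝓝 (0 : ℝ), 0 < F₁.eval s * F₁.eval 0 := by
    have : Continuous fun s : ℝ => F₁.eval s * F₁.eval 0 := by fun_prop
    exact this.continuousAt.eventually (lt_mem_nhds (mul_self_pos.2 hF₁0))
  have hev2 : ∀ᶠ s in 𝓝 (0 : ℝ), (G₁.eval s / F₁.eval s) ^ 2 - H₁.eval s / F₁.eval s < B := by
    have : ContinuousAt (fun s : ℝ => (G₁.eval s / F₁.eval s) ^ 2 - H₁.eval s / F₁.eval s) 0 :=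
      ((G₁.continuousAt.div F₁.continuousAt hF₁0).pow 2).sub
        (H₁.continuousAt.div F₁.continuousAt hF₁0)
    exact this.eventually (gt_mem_nhds (by linarith))
  have hbound (t : ℝ) : ∀ᶠ r in 𝓝[>] (0 : ℝ), |eval (t • e + ((σ * r) • w + p)) f| ≤
      |(σ * r) * F₁.eval (σ * r)| * (1 + M * |t|) ^ d := by
    filter_upwards [hσt.eventually hev1, hσt.eventually hev2, self_mem_nhdsWithin] with r h1 h2 h3
    have h3 : 0 < r := h3
    have hσ0 : σ ≠ 0 := by rintro rfl; norm_num at hσ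
    set s := σ * r with hs
    have hs0 : s ≠ 0 := mul_ne_zero hσ0 h3.ne'
    have hFs : F₁.eval s ≠ 0 := fun h => by simp [h] at h1
    have key := (hyp.2 (s • w + p)).abs_eval_le (M := M) (by rw [eF]; exact mul_ne_zero hs0 hFs)
      (Real.sqrt_nonneg _) ?_ t
    · rwa [eF, eval_restrictLine, natDegree_restrictLine hf hyp.1] at key
    · rw [eF, eG, eH, mul_div_mul_left _ _ hs0]
      have h4 : 0 ≤ H.eval 0 / (s * F₁.eval s) := div_nonneg_of_sign_eq hσ0 h3 h1 hσs
      have h7 : (H.eval 0 + s * H₁.eval s) / (s * F₁.eval s) =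
          H.eval 0 / (s * F₁.eval s) + H₁.eval s / F₁.eval s := by
        field_simp
      rw [h7]
      linarith
  have hzero (t : ℝ) : eval (t • e + p) f = 0 := by
    have c1 : Continuous fun s : ℝ => |eval (t • e + (s • w + p)) f| :=
      ((continuous_eval f).comp (by fun_prop)).abs
    have c2 : Continuous fun s : ℝ => |s * F₁.eval s| * (1 + M * |t|) ^ d := by fun_prop
    have := le_of_tendsto_of_tendsto ((c1.tendsto 0).comp hσt) ((c2.tendsto 0).comp hσt) (hbound t)
    simpa using this
  have : restrictLine f e p = 0 := Polynomial.funext fun t => by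
    rw [eval_restrictLine, hzero, Polynomial.eval_zero]
  apply hyp.1
  rw [← coeff_restrictLine hf e p, this, Polynomial.coeff_zero]

/-! ### Interlacing and sign alternation -/

/-- `β i` is paired with whichever of its neighbours `α i`, `α (i + 1)` is farther in index from
`k`, so both lie on the same side of `α k`. Multiplying over `i` compares the signs of `q` and `p'`
at `α k`. -/
theorem mul_nonneg_of_interlacing {n : ℕ} {α : Fin (n + 1) → ℝ} {β : Fin n → ℝ} (hα : Monotone α)
    (h : ∀ i : Fin n, α i.castSucc ≤ β i ∧ β i ≤ α i.succ) (k : Fin (n + 1)) (i : Fin n) :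
    0 ≤ (α k - β i) * (α k - α (k.succAbove i)) := by
  rcases lt_or_ge i.castSucc k with hk | hk
  · rw [Fin.succAbove_of_castSucc_lt _ _ hk]
    have h1 : α i.succ ≤ α k := hα (Fin.castSucc_lt_iff_succ_le.1 hk)
    have := h i
    exact mul_nonneg (by linarith) (by linarith)
  · rw [Fin.succAbove_of_le_castSucc _ _ hk]
    have h1 : α k ≤ α i.castSucc := hα hk
    have := h i
    exact mul_nonneg_of_nonpos_of_nonpos (by linarith) (by linarith)

theorem mul_pos_of_interlacing {n : ℕ} {α : Fin (n + 1) → ℝ} {β : Fin n → ℝ} (hα : Monotone α)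
    (h : ∀ i : Fin n, α i.castSucc < β i ∧ β i < α i.succ) (k : Fin (n + 1)) (i : Fin n) :
    0 < (α k - β i) * (α k - α (k.succAbove i)) := by
  rcases lt_or_ge i.castSucc k with hk | hk
  · rw [Fin.succAbove_of_castSucc_lt _ _ hk]
    have h1 : α i.succ ≤ α k := hα (Fin.castSucc_lt_iff_succ_le.1 hk)
    have := h i
    exact mul_pos (by linarith) (by linarith)
  · rw [Fin.succAbove_of_le_castSucc _ _ hk]
    have h1 : α k ≤ α i.castSucc := hα hk
    have := h i
    exact mul_pos_of_neg_of_neg (by linarith) (by linarith)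

theorem eval_derivative_C_mul_prod_X_sub_C {n : ℕ} (c : ℝ) (α : Fin (n + 1) → ℝ)
    (k : Fin (n + 1)) :
    (Polynomial.derivative
      (Polynomial.C c * ∏ i, (Polynomial.X - Polynomial.C (α i)))).eval (α k) =
      c * ∏ i : Fin n, (α k - α (k.succAbove i)) := by
  rw [Fin.prod_univ_succAbove _ k]
  simp [Polynomial.derivative_mul, Polynomial.eval_prod]

/-- An interlacer has the sign of the derivative at the zeros. -/
theorem Interlaces.nonneg {p q : Polynomial ℝ} (h : Interlaces q p) {x : ℝ} (hx : p.eval x = 0) :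
    0 ≤ (p.leadingCoeff * p.derivative.eval x) * (q.leadingCoeff * q.eval x) := by
  obtain ⟨hp, hq, n, α, β, hα, hβ, hpα, hqβ, hαβ⟩ := h
  generalize p.leadingCoeff = a at *
  generalize q.leadingCoeff = b at *
  subst hpα hqβ
  have ha : a ≠ 0 := by rintro rfl; simp at hp
  obtain ⟨k, rfl⟩ : ∃ k, x = α k := by
    simpa [Polynomial.eval_prod, Finset.prod_eq_zero_iff, ha, sub_eq_zero] using hx
  rw [eval_derivative_C_mul_prod_X_sub_C]
  have h1 : 0 ≤ ∏ i, (α k - β i) * (α k - α (k.succAbove i)) :=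
    Finset.prod_nonneg fun i _ => mul_nonneg_of_interlacing hα hαβ k i
  rw [Finset.prod_mul_distrib] at h1
  have h2 : 0 ≤ (a * b) ^ 2 * ((∏ i, (α k - β i)) * ∏ i, (α k - α (k.succAbove i))) := by
    positivity
  simp only [Polynomial.eval_mul, Polynomial.eval_C, Polynomial.eval_prod, Polynomial.eval_sub,
    Polynomial.eval_X]
  linarith

/-- The derivative alternates in sign at consecutive simple roots: only the factor comparing the two
roots with each other changes sign, while every other root lies on one side of both. -/
theorem prod_sub_succAbove_mul_neg {n : ℕ} {α : Fin (n + 1) → ℝ} (hα : StrictMono α) (i : Fin n) :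
    (∏ j, (α i.castSucc - α (i.castSucc.succAbove j))) *
      ∏ j, (α i.succ - α (i.succ.succAbove j)) < 0 := by
  rw [← Finset.prod_mul_distrib, ← Finset.mul_prod_erase _ _ (Finset.mem_univ i)]
  refine mul_neg_of_neg_of_pos ?_ (Finset.prod_pos fun j hj => ?_)
  · have := hα (Fin.castSucc_lt_succ (i := i))
    rw [Fin.succAbove_castSucc_self, Fin.succAbove_succ_self]
    nlinarith
  · have hji := Finset.ne_of_mem_erase hj
    rcases lt_or_gt_of_ne hji with h | h
    · rw [Fin.succAbove_of_castSucc_lt _ _ (Fin.castSucc_lt_castSucc_iff.2 h),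
        Fin.succAbove_of_castSucc_lt _ _ ((Fin.castSucc_lt_castSucc_iff.2 h).trans
          Fin.castSucc_lt_succ)]
      have h1 := hα (Fin.castSucc_lt_castSucc_iff.2 h)
      have h2 := hα (Fin.castSucc_lt_succ (i := i))
      exact mul_pos (by linarith) (by linarith)
    · rw [Fin.succAbove_of_le_castSucc _ _ (Fin.castSucc_le_castSucc_iff.2 h.le),
        Fin.succAbove_of_le_castSucc _ _ (Fin.castSucc_lt_iff_succ_le.1
          (Fin.castSucc_lt_castSucc_iff.2 h))]
      have h1 := hα (Fin.succ_lt_succ_iff.2 h)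
      have h2 := hα (Fin.castSucc_lt_succ (i := i))
      exact mul_pos_of_neg_of_neg (by linarith) (by linarith)

/-- The intermediate value theorem gives a root in each of the `n` gaps, and these exhaust the
degree. -/
theorem exists_interlacing_roots_of_pos {n : ℕ} {α : Fin (n + 1) → ℝ} (hα : StrictMono α)
    {q : Polynomial ℝ} (hq : q.natDegree = n) (hq0 : q ≠ 0)
    (h : ∀ k, 0 < q.eval (α k) * ∏ i, (α k - α (k.succAbove i))) :
    ∃ β : Fin n → ℝ, Monotone β ∧ (∀ i, α i.castSucc ≤ β i ∧ β i ≤ α i.succ) ∧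
      q = Polynomial.C q.leadingCoeff * ∏ i, (Polynomial.X - Polynomial.C (β i)) := by
  have hroot (i : Fin n) : ∃ c, α i.castSucc < c ∧ c < α i.succ ∧ q.eval c = 0 := by
    have h1 := h i.castSucc
    have h2 := h i.succ
    have h3 := prod_sub_succAbove_mul_neg hα i
    have hlt := hα (Fin.castSucc_lt_succ (i := i))
    have hneg : q.eval (α i.castSucc) * q.eval (α i.succ) < 0 := by
      by_contra hc
      have := mul_pos h1 h2
      have h4 := mul_nonpos_of_nonneg_of_nonpos (not_lt.1 hc) h3.le
      linarith
    have hcont : ContinuousOn (fun x => q.eval x) (Set.Icc (α i.castSucc) (α i.succ)) :=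
      q.continuous.continuousOn
    obtain ⟨c, hc, hc0⟩ : ∃ c ∈ Set.Ioo (α i.castSucc) (α i.succ), q.eval c = 0 := by
      rcases mul_neg_iff.1 hneg with ⟨ha, hb⟩ | ⟨ha, hb⟩
      · exact intermediate_value_Ioo' hlt.le hcont ⟨hb, ha⟩
      · exact intermediate_value_Ioo hlt.le hcont ⟨ha, hb⟩
    exact ⟨c, hc.1, hc.2, hc0⟩
  choose β hβ1 hβ2 hβ0 using hroot
  have hβ : StrictMono β := fun i j hij =>
    (hβ2 i).trans_le ((hα.monotone (Fin.castSucc_lt_iff_succ_le.1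
      (Fin.castSucc_lt_castSucc_iff.2 hij))).trans (hβ1 j).le)
  refine ⟨β, hβ.monotone, fun i => ⟨(hβ1 i).le, (hβ2 i).le⟩, ?_⟩
  have hm : (∏ i, (Polynomial.X - Polynomial.C (β i))).Monic :=
    Polynomial.monic_prod_of_monic _ _ fun i _ => Polynomial.monic_X_sub_C _
  have hlc : q.leadingCoeff ≠ 0 := Polynomial.leadingCoeff_ne_zero.2 hq0
  have hdeg : q.degree =
      (Polynomial.C q.leadingCoeff * ∏ i, (Polynomial.X - Polynomial.C (β i))).degree := by
    rw [Polynomial.degree_C_mul hlc, Polynomial.degree_prod, Polynomial.degree_eq_natDegree hq0]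
    simp [hq]
  refine Polynomial.eq_of_degree_sub_lt_of_eval_index_eq (s := Finset.univ)
    hβ.injective.injOn ?_ ?_
  · refine (Polynomial.degree_sub_lt_left hdeg hq0 ?_).trans_le ?_
    · rw [Polynomial.leadingCoeff_mul, hm.leadingCoeff, Polynomial.leadingCoeff_C, mul_one]
    · rw [Polynomial.degree_eq_natDegree hq0, hq]; simp
  · intro i _
    rw [hβ0, Polynomial.eval_mul, Polynomial.eval_prod, Finset.prod_eq_zero (Finset.mem_univ i)]
    · simp
    · simp

open Filter Topology in
/-- A polynomial with weakly alternating signs at the zeros of a real-rooted polynomial with simple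
zeros interlaces it. -/
theorem exists_interlacing_roots {n : ℕ} {α : Fin (n + 1) → ℝ} (hα : StrictMono α)
    {q : Polynomial ℝ} (hq : q.natDegree = n) (hq0 : 0 < q.leadingCoeff)
    (h : ∀ k, 0 ≤ q.eval (α k) * ∏ i, (α k - α (k.succAbove i))) :
    ∃ β : Fin n → ℝ, Monotone β ∧ (∀ i, α i.castSucc ≤ β i ∧ β i ≤ α i.succ) ∧
      q = Polynomial.C q.leadingCoeff * ∏ i, (Polynomial.X - Polynomial.C (β i)) := by
  -- The polynomial `r` with roots at the midpoints of the gaps alternates strictly, so `q + εr`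
  -- falls under the strict case for every `ε > 0`.
  set m : Fin n → ℝ := fun i => (α i.castSucc + α i.succ) / 2 with hm
  set r : Polynomial ℝ := ∏ i, (Polynomial.X - Polynomial.C (m i)) with hr
  have hrm : r.Monic := Polynomial.monic_prod_of_monic _ _ fun i _ => Polynomial.monic_X_sub_C _
  have hrn : r.natDegree = n := by simp [hr, Polynomial.natDegree_prod_of_monic,
    Polynomial.monic_X_sub_C]
  have hrpos (k : Fin (n + 1)) : 0 < r.eval (α k) * ∏ i, (α k - α (k.succAbove i)) := by
    rw [hr, Polynomial.eval_prod, ← Finset.prod_mul_distrib]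
    refine Finset.prod_pos fun i _ => ?_
    have := mul_pos_of_interlacing (β := m) hα.monotone (fun i => ?_) k i
    · simpa using this
    · have := hα (Fin.castSucc_lt_succ (i := i))
      simp only [hm]
      constructor <;> linarith
  have hpert (ε : ℝ) (hε : 0 < ε) : ∃ β : Fin n → ℝ, Monotone β ∧
      (∀ i, α i.castSucc ≤ β i ∧ β i ≤ α i.succ) ∧
      q + Polynomial.C ε * r =
        Polynomial.C (q.leadingCoeff + ε) * ∏ i, (Polynomial.X - Polynomial.C (β i)) := by
    have hc : (q + Polynomial.C ε * r).coeff n = q.leadingCoeff + ε := by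
      rw [Polynomial.coeff_add, Polynomial.coeff_C_mul, Polynomial.leadingCoeff, hq]
      nth_rw 2 [← hrn]
      rw [hrm.coeff_natDegree, mul_one]
    have hc0 : q.leadingCoeff + ε ≠ 0 := by positivity
    have hn : (q + Polynomial.C ε * r).natDegree = n := by
      refine le_antisymm (Polynomial.natDegree_add_le_of_degree_le hq.le
        ((Polynomial.natDegree_C_mul_le _ _).trans hrn.le)) ?_
      exact Polynomial.le_natDegree_of_ne_zero (by rw [hc]; exact hc0)
    have hne : q + Polynomial.C ε * r ≠ 0 := by
      intro h0; rw [h0, Polynomial.coeff_zero] at hc; exact hc0 hc.symm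
    obtain ⟨β, h1, h2, h3⟩ := exists_interlacing_roots_of_pos hα hn hne (fun k => by
      have h4 := h k
      have h5 := mul_pos hε (hrpos k)
      simp only [Polynomial.eval_add, Polynomial.eval_mul, Polynomial.eval_C]
      linarith)
    refine ⟨β, h1, h2, ?_⟩
    rwa [Polynomial.leadingCoeff, hn, hc] at h3
  choose! β hβm hβ hβq using hpert
  have hu : Tendsto (fun k : ℕ => 1 / ((k : ℝ) + 1)) atTop (𝓝 0) :=
    tendsto_one_div_add_atTop_nhds_zero_nat
  have hupos (k : ℕ) : 0 < 1 / ((k : ℝ) + 1) := by positivity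
  -- The roots of `q + εr` stay in a compact box; a limit of them as `ε → 0` along a subsequence
  -- gives the roots of `q`.
  obtain ⟨b, hb, φ, hφ, hlim⟩ := (isCompact_Icc : IsCompact (Set.Icc (fun i : Fin n => α i.castSucc)
    (fun i => α i.succ))).tendsto_subseq (x := fun k : ℕ => β (1 / ((k : ℝ) + 1)))
    (fun k => ⟨fun i => (hβ _ (hupos k) i).1, fun i => (hβ _ (hupos k) i).2⟩)
  have hu' := hu.comp hφ.tendsto_atTop
  refine ⟨b, ?_, fun i => ⟨hb.1 i, hb.2 i⟩, Polynomial.funext fun x => ?_⟩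
  · intro i j hij
    exact le_of_tendsto_of_tendsto' (tendsto_pi_nhds.1 hlim i) (tendsto_pi_nhds.1 hlim j)
      fun k => hβm _ (hupos _) hij
  · have c1 : Tendsto (fun k : ℕ => q.eval x + (1 / ((φ k : ℝ) + 1)) * r.eval x) atTop
        (𝓝 (q.eval x + 0 * r.eval x)) := tendsto_const_nhds.add (hu'.mul_const _)
    have c2 : Tendsto (fun k : ℕ => (q.leadingCoeff + 1 / ((φ k : ℝ) + 1)) *
        ∏ i, (x - β (1 / ((φ k : ℝ) + 1)) i)) atTop
        (𝓝 ((q.leadingCoeff + 0) * ∏ i, (x - b i))) :=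
      (tendsto_const_nhds.add hu').mul
        (tendsto_finsetProd _ fun i _ => tendsto_const_nhds.sub (tendsto_pi_nhds.1 hlim i))
    have heq (k : ℕ) : q.eval x + (1 / ((φ k : ℝ) + 1)) * r.eval x =
        (q.leadingCoeff + 1 / ((φ k : ℝ) + 1)) * ∏ i, (x - β (1 / ((φ k : ℝ) + 1)) i) := by
      have := congrArg (Polynomial.eval x) (hβq _ (hupos (φ k)))
      simpa only [Polynomial.eval_add, Polynomial.eval_mul, Polynomial.eval_C,
        Polynomial.eval_prod, Polynomial.eval_sub, Polynomial.eval_X] using this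
    have := tendsto_nhds_unique (c1.congr heq) c2
    simpa [Polynomial.eval_prod] using this

/-! ### Interlacers and signs on the curve -/

/-- Smoothness at the real point supplies a coordinate direction with nonzero derivative, and
hyperbolicity transfers this to `e`. -/
theorem dirDeriv_ne_zero_of_isSmoothCurve {f : MvPolynomial (Fin 3) ℝ} {d : ℕ}
    (hf : f.IsHomogeneous d) {e : Fin 3 → ℝ} (hyp : IsHyperbolic f e) (hs : IsSmoothCurve f)
    {p : Fin 3 → ℝ} (hp0 : p ≠ 0) (hp : eval p f = 0) : eval p (dirDeriv e f) ≠ 0 := by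
  have hc (q : MvPolynomial (Fin 3) ℝ) :
      aeval (fun i => (p i : ℂ)) q = ((eval p q : ℝ) : ℂ) := by
    have := aeval_algebraMap_apply (A := ℝ) ℂ p q
    simpa [aeval_eq_eval, Function.comp_def] using this
  obtain ⟨i, hi⟩ := hs (fun i => (p i : ℂ)) (fun h => hp0 (by
    ext i; simpa using congrFun h i)) (by rw [hc, hp]; simp)
  refine hyp.eval_dirDeriv_ne_zero hf (w := Pi.single i 1) hp ?_
  rw [hc] at hi
  rw [eval_dirDeriv, Finset.sum_eq_single i]
  · simpa using hi
  · intro j _ hj; simp [hj]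
  · simp

theorem interlacerCone_nonneg {f g : MvPolynomial (Fin 3) ℝ} {d : ℕ} (hf : f.IsHomogeneous d)
    {e : Fin 3 → ℝ} (hyp : IsHyperbolic f e) (hg : g ∈ interlacerCone d f e) {p : Fin 3 → ℝ}
    (hp : eval p f = 0) : 0 ≤ eval e f * eval p (dirDeriv e f) * eval p g := by
  obtain ⟨hgd, hint, hge⟩ := hg
  have h := (hint p).nonneg (x := 0) (by simp [eval_restrictLine, hp])
  rw [leadingCoeff_restrictLine hf hyp.1, leadingCoeff_restrictLine hgd hge.ne',
    derivative_restrictLine] at h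
  simp only [eval_restrictLine, zero_smul, zero_add] at h
  refine nonneg_of_mul_nonneg_left (b := eval e g) ?_ hge
  linarith

theorem restrictLine_smul {f : MvPolynomial (Fin 3) ℝ} {d : ℕ} (hf : f.IsHomogeneous d)
    (e : Fin 3 → ℝ) (c : ℝ) : restrictLine f e (c • e) =
      Polynomial.C (eval e f) * ∏ _i : Fin d, (Polynomial.X - Polynomial.C (-c)) := by
  refine Polynomial.funext fun t => ?_
  rw [eval_restrictLine, ← add_smul, eval_smul_of_isHomogeneous hf]
  simp [mul_comm]

theorem exists_strictMono_roots {p : Polynomial ℝ} (hp : p.Splits) {n : ℕ}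
    (hn : p.natDegree = n) (hsimple : ∀ x, p.eval x = 0 → p.derivative.eval x ≠ 0) :
    ∃ α : Fin n → ℝ, StrictMono α ∧
      p = Polynomial.C p.leadingCoeff * ∏ i, (Polynomial.X - Polynomial.C (α i)) := by
  have hp0 : p ≠ 0 := by rintro rfl; simpa using hsimple 0
  have hnd : p.roots.Nodup := by
    rw [Multiset.nodup_iff_count_le_one]
    intro x
    rw [Polynomial.count_roots]
    by_contra! h
    have := (Polynomial.one_lt_rootMultiplicity_iff_isRoot hp0).1 h
    exact hsimple x this.1 this.2
  have hcard : p.roots.toFinset.card = n := by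
    rw [Multiset.toFinset_card_of_nodup hnd, ← hp.natDegree_eq_card_roots, hn]
  refine ⟨p.roots.toFinset.orderEmbOfFin hcard, (p.roots.toFinset.orderEmbOfFin hcard).strictMono,
    ?_⟩
  have h1 : ∏ i, (Polynomial.X - Polynomial.C (p.roots.toFinset.orderEmbOfFin hcard i)) =
      ∏ x ∈ p.roots.toFinset, (Polynomial.X - Polynomial.C x) := by
    conv_rhs => rw [← Finset.map_orderEmbOfFin_univ p.roots.toFinset hcard, Finset.prod_map]
    rfl
  rw [h1, Finset.prod, Multiset.toFinset_val, hnd.dedup]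
  exact hp.eq_prod_roots

/-- Converse of `interlacerCone_nonneg`: on a line missing the origin `f` has simple roots, where
its derivative alternates, so the sign condition makes `h` alternate weakly. -/
theorem mem_interlacerCone_of_nonneg {f h : MvPolynomial (Fin 3) ℝ} {d : ℕ} (hd : 1 ≤ d)
    (hf : f.IsHomogeneous d) {e : Fin 3 → ℝ} (hyp : IsHyperbolic f e) (hs : IsSmoothCurve f)
    (hh : h.IsHomogeneous (d - 1)) (he : 0 < eval e h)
    (hsign : ∀ p, p ≠ 0 → eval p f = 0 → 0 ≤ eval e f * eval p (dirDeriv e f) * eval p h) :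
    h ∈ interlacerCone d f e := by
  refine ⟨hh, fun v => ?_, he⟩
  obtain ⟨n, rfl⟩ : ∃ n, d = n + 1 := ⟨d - 1, by omega⟩
  rw [Nat.add_sub_cancel] at hh
  have hlf := leadingCoeff_restrictLine hf hyp.1 v
  have hlh := leadingCoeff_restrictLine hh he.ne' v
  refine ⟨Polynomial.leadingCoeff_ne_zero.1 (by rw [hlf]; exact hyp.1),
    Polynomial.leadingCoeff_ne_zero.1 (by rw [hlh]; exact he.ne'), n, ?_⟩
  rw [hlf, hlh]
  -- If `v` is a multiple of `e`, the line passes through the origin and simplicity of the roots is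
  -- not available; there both restrictions are constants times powers of `X + c`.
  by_cases hv : ∃ c : ℝ, v = c • e
  · obtain ⟨c, rfl⟩ := hv
    exact ⟨fun _ => -c, fun _ => -c, monotone_const, monotone_const, restrictLine_smul hf e c,
      restrictLine_smul hh e c, fun _ => ⟨le_rfl, le_rfl⟩⟩
  · have hne (t : ℝ) : t • e + v ≠ 0 := fun h0 => hv ⟨-t, by
      rw [neg_smul]; exact eq_neg_of_add_eq_zero_right h0⟩
    obtain ⟨α, hα, hαf⟩ := exists_strictMono_roots (hyp.2 v) (natDegree_restrictLine hf hyp.1 v)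
      (fun t ht => by
        rw [derivative_restrictLine, eval_restrictLine]
        rw [eval_restrictLine] at ht
        exact dirDeriv_ne_zero_of_isSmoothCurve hf hyp hs (hne t) ht)
    rw [hlf] at hαf
    obtain ⟨β, hβ, hαβ, hβh⟩ := exists_interlacing_roots hα (q := restrictLine h e v)
      (natDegree_restrictLine hh he.ne' v) (by rwa [hlh]) (fun k => by
        have h0 : eval (α k • e + v) f = 0 := by
          rw [← eval_restrictLine, hαf]
          simp [Polynomial.eval_prod, Finset.prod_eq_zero (Finset.mem_univ k)]
        have h1 := hsign _ (hne _) h0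
        rw [← eval_restrictLine (dirDeriv e f), ← derivative_restrictLine, hαf,
          eval_derivative_C_mul_prod_X_sub_C, ← eval_restrictLine] at h1
        have h2 : 0 < eval e f ^ 2 := by have := hyp.1; positivity
        refine nonneg_of_mul_nonneg_left (b := eval e f ^ 2) ?_ h2
        linarith)
    rw [hlh] at hβh
    exact ⟨α, β, hα.monotone, hβ, hαf, hβh, hαβ⟩

/-! ### Smooth plane curves are irreducible -/

/-- The homomorphism that scales all variables by a new variable `T`. -/
def scaleVars (σ R : Type*) [CommRing R] : MvPolynomial σ R →ₐ[R] Polynomial (MvPolynomial σ R) :=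
  aeval ((Polynomial.X : Polynomial (MvPolynomial σ R)) • fun i => Polynomial.C (X i))

theorem scaleVars_of_isHomogeneous {σ R : Type*} [CommRing R] {p : MvPolynomial σ R} {n : ℕ}
    (hp : p.IsHomogeneous n) : scaleVars σ R p = Polynomial.monomial n p := by
  have h : aeval (fun i : σ => (Polynomial.C (X i) : Polynomial (MvPolynomial σ R))) p =
      Polynomial.C p := by
    have := aeval_algebraMap_apply (Polynomial (MvPolynomial σ R)) (X : σ → MvPolynomial σ R) p
    simpa [aeval_X_left, Function.comp_def] using this
  rw [scaleVars, aeval_smul_of_isHomogeneous hp, h, mul_comm, Polynomial.C_mul_X_pow_eq_monomial]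

theorem coeff_scaleVars {σ R : Type*} [CommRing R] (p : MvPolynomial σ R) (n : ℕ) :
    (scaleVars σ R p).coeff n = homogeneousComponent n p := by
  conv_lhs => rw [← sum_homogeneousComponent p, map_sum, Polynomial.finsetSum_coeff]
  simp_rw [scaleVars_of_isHomogeneous (homogeneousComponent_isHomogeneous _ p),
    Polynomial.coeff_monomial]
  rw [Finset.sum_ite_eq']
  split_ifs with h
  · rfl
  · exact (homogeneousComponent_eq_zero _ _ (by rw [Finset.mem_range] at h; omega)).symm

theorem scaleVars_injective {σ R : Type*} [CommRing R] : Function.Injective (scaleVars σ R) := by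
  intro p q h
  rw [← sum_homogeneousComponent p, ← sum_homogeneousComponent q]
  have hc (n : ℕ) : homogeneousComponent n p = homogeneousComponent n q := by
    rw [← coeff_scaleVars, ← coeff_scaleVars, h]
  have hs (r : MvPolynomial σ R) (N : ℕ) (hN : r.totalDegree ≤ N) :
      ∑ i ∈ Finset.range (r.totalDegree + 1), homogeneousComponent i r =
        ∑ i ∈ Finset.range (N + 1), homogeneousComponent i r :=
    Finset.sum_subset (Finset.range_mono (by omega)) fun i _ hi =>
      homogeneousComponent_eq_zero _ _ (by rw [Finset.mem_range] at hi; omega)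
  rw [hs p _ (le_max_left p.totalDegree q.totalDegree),
    hs q _ (le_max_right p.totalDegree q.totalDegree)]
  exact Finset.sum_congr rfl fun i _ => hc i

/-- A factor of a nonzero homogeneous polynomial is homogeneous. -/
theorem MvPolynomial.IsHomogeneous.exists_of_mul {σ R : Type*} [CommRing R] [IsDomain R]
    {a b : MvPolynomial σ R} {d : ℕ} (h : (a * b).IsHomogeneous d) (h0 : a * b ≠ 0) :
    ∃ k l, a.IsHomogeneous k ∧ b.IsHomogeneous l := by
  have ha : scaleVars σ R a ≠ 0 := fun h1 => left_ne_zero_of_mul h0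
    (scaleVars_injective (by rw [h1, map_zero]))
  have hb : scaleVars σ R b ≠ 0 := fun h1 => right_ne_zero_of_mul h0
    (scaleVars_injective (by rw [h1, map_zero]))
  have hab : scaleVars σ R a * scaleVars σ R b = Polynomial.monomial d (a * b) := by
    rw [← map_mul, scaleVars_of_isHomogeneous h]
  -- Both the degree and the trailing degree in `T` are additive and agree on the product, so they
  -- agree on each factor, which is thus a monomial in `T`.
  have h1 := Polynomial.natDegree_mul ha hb
  have h2 := Polynomial.natTrailingDegree_mul ha hb
  rw [hab, Polynomial.natDegree_monomial_eq _ h0] at h1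
  rw [hab, Polynomial.natTrailingDegree_monomial h0] at h2
  have h3 := Polynomial.natTrailingDegree_le_natDegree (scaleVars σ R a)
  have h4 := Polynomial.natTrailingDegree_le_natDegree (scaleVars σ R b)
  have key (p : MvPolynomial σ R)
      (hp : (scaleVars σ R p).natDegree ≤ (scaleVars σ R p).natTrailingDegree) :
      p.IsHomogeneous (scaleVars σ R p).natDegree := by
    have hsum : (∑ i ∈ Finset.range (p.totalDegree + 1), homogeneousComponent i p).IsHomogeneous
        (scaleVars σ R p).natDegree := IsHomogeneous.sum _ _ _ fun i _ => ?_
    · rwa [sum_homogeneousComponent p] at hsum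
    by_cases hi : i = (scaleVars σ R p).natDegree
    · rw [hi]; exact homogeneousComponent_isHomogeneous _ _
    · rw [← coeff_scaleVars p i]
      rcases lt_or_gt_of_ne hi with h | h
      · rw [Polynomial.coeff_eq_zero_of_lt_natTrailingDegree (h.trans_le hp)]
        exact isHomogeneous_zero _ _ _
      · rw [Polynomial.coeff_eq_zero_of_natDegree_lt h]
        exact isHomogeneous_zero _ _ _
  exact ⟨_, _, key a (by omega), key b (by omega)⟩

/-- The prime ideal of polynomials vanishing on the common zero set of the variables in `s`. -/
def coordIdeal {K : Type*} [Field K] (s : Finset (Fin 3)) : Ideal (MvPolynomial (Fin 3) K) :=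
  RingHom.ker (aeval fun i => if i ∈ s then 0 else X i :
    MvPolynomial (Fin 3) K →ₐ[K] MvPolynomial (Fin 3) K)

instance {K : Type*} [Field K] (s : Finset (Fin 3)) : (coordIdeal (K := K) s).IsPrime :=
  RingHom.ker_isPrime _

theorem X_mem_coordIdeal {K : Type*} [Field K] {s : Finset (Fin 3)} {i : Fin 3} :
    (X i : MvPolynomial (Fin 3) K) ∈ coordIdeal s ↔ i ∈ s := by
  rw [coordIdeal, RingHom.mem_ker]
  by_cases h : i ∈ s <;> simp [h]

theorem coordIdeal_mono {K : Type*} [Field K] {s t : Finset (Fin 3)} (h : s ⊆ t) :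
    coordIdeal (K := K) s ≤ coordIdeal t := by
  intro p hp
  have hc : (aeval fun i => if i ∈ t then 0 else X i :
      MvPolynomial (Fin 3) K →ₐ[K] MvPolynomial (Fin 3) K) =
      (aeval fun i => if i ∈ t then 0 else X i :
        MvPolynomial (Fin 3) K →ₐ[K] MvPolynomial (Fin 3) K).comp
      (aeval fun i => if i ∈ s then 0 else X i) := by
    ext i : 1
    by_cases hi : i ∈ s
    · simp [hi, h hi]
    · simp [hi]
  rw [coordIdeal, RingHom.mem_ker] at hp ⊢
  rw [hc, AlgHom.comp_apply, hp, map_zero]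

theorem coordIdeal_lt {K : Type*} [Field K] {s t : Finset (Fin 3)} (h : s ⊂ t) :
    coordIdeal (K := K) s < coordIdeal t := by
  obtain ⟨hst, hts⟩ := h
  refine lt_of_le_of_ne (coordIdeal_mono hst) fun heq => hts fun i hi => ?_
  rw [← X_mem_coordIdeal (K := K), heq, X_mem_coordIdeal]
  exact hi

/-- The chain of primes `0 ⊂ (X₀) ⊂ (X₀, X₁) ⊂ (X₀, X₁, X₂)`. -/
theorem three_le_height_coordIdeal_univ {K : Type*} [Field K] :
    3 ≤ (coordIdeal (K := K) Finset.univ).height := by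
  have h1 := Ideal.height_strict_mono_of_isPrime_of_isPrime
    (coordIdeal_lt (K := K) (s := ∅) (t := {0}) (by decide))
  have h2 := Ideal.height_strict_mono_of_isPrime_of_isPrime
    (coordIdeal_lt (K := K) (s := {0}) (t := {0, 1}) (by decide))
  have h3 := Ideal.height_strict_mono_of_isPrime_of_isPrime
    (coordIdeal_lt (K := K) (s := {0, 1}) (t := Finset.univ) (by decide))
  have h1' := Order.add_one_le_of_lt h1
  have h2' := Order.add_one_le_of_lt h2
  have h3' := Order.add_one_le_of_lt h3
  calc (3 : ℕ∞) = 0 + 1 + 1 + 1 := by norm_num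
    _ ≤ (coordIdeal (K := K) ∅).height + 1 + 1 + 1 := by gcongr; exact zero_le
    _ ≤ (coordIdeal (K := K) {0}).height + 1 + 1 := by gcongr
    _ ≤ (coordIdeal (K := K) {0, 1}).height + 1 := by gcongr
    _ ≤ _ := h3'

/-- Two complex projective plane curves intersect. -/
theorem exists_common_zero {a b : MvPolynomial (Fin 3) ℂ} {k l : ℕ} (ha : a.IsHomogeneous k)
    (hb : b.IsHomogeneous l) (hk : k ≠ 0) (hl : l ≠ 0) :
    ∃ v : Fin 3 → ℂ, v ≠ 0 ∧ eval v a = 0 ∧ eval v b = 0 := by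
  by_contra! hno
  set I : Ideal (MvPolynomial (Fin 3) ℂ) := Ideal.span {a, b} with hI
  have h0 {c : MvPolynomial (Fin 3) ℂ} {n : ℕ} (hc : c.IsHomogeneous n) (hn : n ≠ 0) :
      eval 0 c = 0 := by
    simpa [hn] using eval_smul_of_isHomogeneous hc 0 0
  have hZ : zeroLocus ℂ I = {0} := by
    rw [hI, zeroLocus_span]
    ext v
    simp only [Set.mem_insert_iff, Set.mem_singleton_iff, forall_eq_or_imp, forall_eq,
      Set.mem_ofPred_eq, aeval_eq_eval]
    constructor
    · rintro ⟨h1, h2⟩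
      by_contra hv
      exact hno v hv h1 h2
    · rintro rfl
      exact ⟨h0 ha hk, h0 hb hl⟩
  -- If the origin were the only common zero, the Nullstellensatz would make its maximal ideal the
  -- radical of `(a, b)`, hence a minimal prime over two elements. Krull's height theorem bounds its
  -- height by `2`, but it is at least `3`.
  have hrad := vanishingIdeal_zeroLocus_eq_radical (k := ℂ) (K := ℂ) I
  rw [hZ] at hrad
  have hmem : vanishingIdeal ℂ {(0 : Fin 3 → ℂ)} ∈ I.minimalPrimes := by
    rw [← Ideal.radical_minimalPrimes, ← hrad, Ideal.minimalPrimes_eq_subsingleton_self]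
    rfl
  have h2 := Ideal.height_le_card_of_mem_minimalPrimes_span (by simp) hmem
  have hle : coordIdeal Finset.univ ≤ vanishingIdeal ℂ {(0 : Fin 3 → ℂ)} := by
    intro p hp
    rw [mem_vanishingIdeal_singleton_iff]
    rw [coordIdeal, RingHom.mem_ker] at hp
    have := congrArg (eval (0 : Fin 3 → ℂ)) hp
    rw [map_aeval] at this
    simpa [aeval_def, Pi.zero_def] using this
  have h3 := three_le_height_coordIdeal_univ.trans ((Ideal.height_mono hle).trans h2)
  have h4 : ({a, b} : Set (MvPolynomial (Fin 3) ℂ)).ncard ≤ 2 :=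
    (Set.ncard_insert_le _ _).trans (by simp)
  have : (3 : ℕ) ≤ ({a, b} : Set (MvPolynomial (Fin 3) ℂ)).ncard := by exact_mod_cast h3
  omega

/-- Two nonconstant factors would be homogeneous and meet at a complex point, where the product rule
kills the whole gradient. -/
theorem IsSmoothCurve.irreducible {f : MvPolynomial (Fin 3) ℝ} {d : ℕ} (hd : 1 ≤ d)
    (hf : f.IsHomogeneous d) (hf0 : f ≠ 0) (hs : IsSmoothCurve f) : Irreducible f := by
  have hunit {c : MvPolynomial (Fin 3) ℝ} (hc0 : c ≠ 0) (hc : c.IsHomogeneous 0) : IsUnit c := by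
    rw [← totalDegree_zero_iff_isHomogeneous, totalDegree_eq_zero_iff_eq_C] at hc
    rw [hc]
    refine (IsUnit.mk0 _ fun h => hc0 ?_).map C
    rw [hc, h, C_0]
  refine ⟨fun hu => ?_, fun a b hab => ?_⟩
  · have := (isUnit_iff_totalDegree_of_isReduced.1 hu).2
    rw [hf.totalDegree hf0] at this
    omega
  · subst hab
    obtain ⟨k, l, ha, hb⟩ := hf.exists_of_mul hf0
    by_contra! hcon
    have hk : k ≠ 0 := by rintro rfl; exact hcon.1 (hunit (left_ne_zero_of_mul hf0) ha)
    have hl : l ≠ 0 := by rintro rfl; exact hcon.2 (hunit (right_ne_zero_of_mul hf0) hb)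
    obtain ⟨v, hv, h1, h2⟩ := exists_common_zero (ha.map (algebraMap ℝ ℂ))
      (hb.map (algebraMap ℝ ℂ)) hk hl
    rw [eval_map, ← aeval_def] at h1 h2
    obtain ⟨i, hi⟩ := hs v hv (by rw [map_mul, h1, zero_mul])
    rw [pderiv_mul, map_add, map_mul, map_mul, h1, h2, mul_zero, zero_mul, add_zero] at hi
    exact hi rfl

/-! ### Local rings with principal maximal ideal -/

section PrincipalMaximalIdeal

variable {K A : Type*} [Field K] [CommRing A] [Algebra K A] {t : A}

/-- By Krull's intersection theorem there is a last power of the maximal ideal containing `g`; the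
cofactor is then a unit. -/
theorem exists_eq_unit_mul_pow [IsLocalRing A] [IsNoetherianRing A]
    (ht : IsLocalRing.maximalIdeal A = Ideal.span {t}) {g : A} (hg : g ≠ 0) : ∃ (m : ℕ) (u : A), IsUnit u ∧ g = u * t ^ m := by
  have htop : IsLocalRing.maximalIdeal A ≠ ⊤ := Ideal.IsPrime.ne_top'
  have h := Ideal.iInf_pow_eq_bot_of_isLocalRing _ htop
  have hex : ∃ n, g ∉ IsLocalRing.maximalIdeal A ^ n := by
    by_contra! hc
    exact hg (by rw [← Ideal.mem_bot, ← h]; exact Ideal.mem_iInf.2 hc)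
  classical
  have hn := Nat.find_spec hex
  have hmin := fun k hk => not_not.1 (Nat.find_min hex (m := k) hk)
  set n := Nat.find hex
  obtain ⟨m, hm⟩ : ∃ m, n = m + 1 := Nat.exists_eq_succ_of_ne_zero (by
    intro h0; rw [h0] at hn; simp at hn)
  have hgm := hmin m (by omega)
  rw [ht, Ideal.span_singleton_pow, Ideal.mem_span_singleton'] at hgm
  obtain ⟨u, hu⟩ := hgm
  refine ⟨m, u, ?_, hu.symm⟩
  by_contra hnu
  have hu' : u ∈ IsLocalRing.maximalIdeal A := (IsLocalRing.mem_maximalIdeal u).2 hnu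
  rw [ht, Ideal.mem_span_singleton'] at hu'
  obtain ⟨w, rfl⟩ := hu'
  apply hn
  rw [hm, ht, Ideal.span_singleton_pow, Ideal.mem_span_singleton', ← hu]
  exact ⟨w, by ring⟩

/-- Non-nilpotence of `t` replaces a domain hypothesis: writing `y = u t^m` would give `t^(m+1) =
0`. -/
theorem eq_zero_of_mul_eq_zero [IsLocalRing A] [IsNoetherianRing A]
    (ht : IsLocalRing.maximalIdeal A = Ideal.span {t}) (hnil : ¬ IsNilpotent t) {y : A}
    (hy : t * y = 0) : y = 0 := by
  by_contra h
  obtain ⟨m, u, hu, rfl⟩ := exists_eq_unit_mul_pow ht h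
  refine hnil ⟨m + 1, hu.mul_right_eq_zero.1 ?_⟩
  rw [← hy]; ring

theorem exists_sub_sum_mem_span_pow (hres : ∀ y : A, ∃ c : K, t ∣ y - algebraMap K A c) (m : ℕ)
    (y : A) : ∃ c : ℕ → K, t ^ m ∣ y - ∑ i ∈ Finset.range m, algebraMap K A (c i) * t ^ i := by
  induction m generalizing y with
  | zero => exact ⟨0, by simp⟩
  | succ m ih =>
    obtain ⟨c, z, hz⟩ := hres y
    obtain ⟨c', hc'⟩ := ih z
    refine ⟨fun i => i.casesOn c c', ?_⟩
    have : y - ∑ i ∈ Finset.range (m + 1),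
        algebraMap K A ((fun i => i.casesOn c c' : ℕ → K) i) * t ^ i =
        t * (z - ∑ i ∈ Finset.range m, algebraMap K A (c' i) * t ^ i) := by
      rw [Finset.sum_range_succ', mul_sub, ← hz, Finset.mul_sum]
      simp only [pow_zero, mul_one, pow_succ]
      have : ∀ i ∈ Finset.range m, algebraMap K A (c' i) * (t ^ i * t) =
        t * (algebraMap K A (c' i) * t ^ i) := fun i _ => by ring
      rw [Finset.sum_congr rfl this]
      exact (sub_add_eq_sub_sub_swap _ _ _)
    rw [this, pow_succ']
    exact mul_dvd_mul_left t hc'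

theorem coeff_eq_zero_of_pow_dvd_sum [IsLocalRing A] [IsNoetherianRing A]
    (ht : IsLocalRing.maximalIdeal A = Ideal.span {t}) (hnil : ¬ IsNilpotent t) (m : ℕ)
    (c : ℕ → K) (h : t ^ m ∣ ∑ i ∈ Finset.range m, algebraMap K A (c i) * t ^ i) :
    ∀ i < m, c i = 0 := by
  induction m generalizing c with
  | zero => simp
  | succ m ih =>
    have hsum : ∑ i ∈ Finset.range (m + 1), algebraMap K A (c i) * t ^ i =
        t * (∑ i ∈ Finset.range m, algebraMap K A (c (i + 1)) * t ^ i) + algebraMap K A (c 0) := by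
      rw [Finset.sum_range_succ', Finset.mul_sum]
      simp only [pow_zero, mul_one, pow_succ]
      congr 1
      exact Finset.sum_congr rfl fun i _ => by ring
    rw [hsum] at h
    have h0 : c 0 = 0 := by
      by_contra hc
      have h1 : t ∣ algebraMap K A (c 0) :=
        (dvd_add_right (dvd_mul_right t _)).1 ((dvd_pow_self t m.succ_ne_zero).trans h)
      have h2 : algebraMap K A (c 0) ∈ IsLocalRing.maximalIdeal A := by
        rw [ht]; exact Ideal.mem_span_singleton.2 h1
      exact (IsLocalRing.mem_maximalIdeal _).1 h2 ((IsUnit.mk0 _ hc).map (algebraMap K A))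
    rw [h0, map_zero, add_zero] at h
    obtain ⟨z, hz⟩ := h
    have h1 := ih (fun i => c (i + 1)) ⟨z, by
      refine sub_eq_zero.1 (eq_zero_of_mul_eq_zero ht hnil ?_)
      rw [mul_sub, hz]; ring⟩
    intro i hi
    cases i with
    | zero => exact h0
    | succ i => exact h1 i (by omega)

/-- The powers `1, t, …, t^(m-1)` form a basis: truncated expansion in `t` gives spanning, and
comparing lowest coefficients gives independence. -/
theorem finrank_quotient_span_pow [IsLocalRing A] [IsNoetherianRing A]
    (ht : IsLocalRing.maximalIdeal A = Ideal.span {t}) (hnil : ¬ IsNilpotent t)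
    (hres : ∀ y : A, ∃ c : K, t ∣ y - algebraMap K A c) (m : ℕ) :
    Module.Finite K (A ⧸ Ideal.span {t ^ m}) ∧ Module.finrank K (A ⧸ Ideal.span {t ^ m}) = m := by
  let ψ : (Fin m → K) →ₗ[K] A ⧸ Ideal.span {t ^ m} :=
    Fintype.linearCombination K fun i : Fin m => Ideal.Quotient.mk _ (t ^ (i : ℕ))
  have hψ (c : ℕ → K) : ψ (fun i => c i) = Ideal.Quotient.mk _
      (∑ i ∈ Finset.range m, algebraMap K A (c i) * t ^ i) := by
    rw [Finset.sum_range, map_sum, Fintype.linearCombination_apply]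
    refine Finset.sum_congr rfl fun i _ => ?_
    rw [← Algebra.smul_def]
    rfl
  have hbij : Function.Bijective ψ := by
    constructor
    · rw [injective_iff_map_eq_zero]
      intro c hc
      obtain ⟨c, rfl⟩ : ∃ c' : ℕ → K, c = fun i : Fin m => c' i :=
        ⟨fun k => if h : k < m then c ⟨k, h⟩ else 0, by ext i; simp⟩
      rw [hψ, Ideal.Quotient.eq_zero_iff_mem, Ideal.mem_span_singleton] at hc
      have := coeff_eq_zero_of_pow_dvd_sum ht hnil m _ hc
      ext i
      simpa using this i i.2
    · intro y
      obtain ⟨y, rfl⟩ := Ideal.Quotient.mk_surjective y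
      obtain ⟨c, hc⟩ := exists_sub_sum_mem_span_pow hres m y
      refine ⟨fun i => c i, ?_⟩
      rw [hψ, eq_comm, Ideal.Quotient.eq, Ideal.mem_span_singleton]
      exact hc
  let E := LinearEquiv.ofBijective ψ hbij
  exact ⟨Module.Finite.equiv E, by rw [← E.finrank_eq]; simp⟩

/-- In a Noetherian local ring whose maximal ideal is generated by two elements `x`, `l`, an element
`g` is modulo `x` a unit times a power `l ^ m`, and the quotient by `x`, `g` has dimension `m`. -/
theorem exists_unit_mul_pow_mod [IsLocalRing A] [IsNoetherianRing A] {x l g : A}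
    (hmax : IsLocalRing.maximalIdeal A = Ideal.span {x, l})
    (hres : ∀ y : A, ∃ c : K, y - algebraMap K A c ∈ IsLocalRing.maximalIdeal A)
    (hl : ∀ n, ¬ x ∣ l ^ n) (hg : ¬ x ∣ g) :
    ∃ (m : ℕ) (u : A), IsUnit u ∧ x ∣ g - u * l ^ m ∧
      Module.Finite K (A ⧸ Ideal.span {x, g}) ∧ Module.finrank K (A ⧸ Ideal.span {x, g}) = m := by
  set I : Ideal A := Ideal.span {x} with hI
  set π := Ideal.Quotient.mk I with hπ
  have hdvd {y : A} : π y = 0 ↔ x ∣ y := by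
    rw [Ideal.Quotient.eq_zero_iff_mem, Ideal.mem_span_singleton]
  have hx0 : π x = 0 := hdvd.2 dvd_rfl
  have hIle : I ≤ IsLocalRing.maximalIdeal A := by
    rw [hmax]
    exact Ideal.span_mono (by simp)
  have : Nontrivial (A ⧸ I) := Ideal.Quotient.nontrivial_iff.2
    (ne_top_of_le_ne_top Ideal.IsPrime.ne_top' hIle)
  have hlocal : IsLocalRing (A ⧸ I) :=
    IsLocalRing.of_surjective' π Ideal.Quotient.mk_surjective
  have hloc : IsLocalHom π :=
    IsLocalHom.of_surjective π Ideal.Quotient.mk_surjective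
  have hmaxA : IsLocalRing.maximalIdeal (A ⧸ I) = Ideal.span {π l} := by
    have h1 : Ideal.span {π l} = (IsLocalRing.maximalIdeal A).map π := by
      rw [hmax, Ideal.map_span, Set.image_pair, hx0, Ideal.span_insert_zero]
    rw [h1]
    apply le_antisymm
    · intro y hy
      obtain ⟨y, rfl⟩ := Ideal.Quotient.mk_surjective y
      refine Ideal.mem_map_of_mem π ?_
      rw [IsLocalRing.mem_maximalIdeal] at hy ⊢
      exact fun hu => hy (hu.map π)
    · rw [Ideal.map_le_iff_le_comap]
      intro y hy
      rw [Ideal.mem_comap, IsLocalRing.mem_maximalIdeal]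
      exact fun hu => (IsLocalRing.mem_maximalIdeal y).1 hy (isUnit_of_map_unit π y hu)
  have hresA (y : A ⧸ I) : ∃ c : K, π l ∣ y - algebraMap K _ c := by
    obtain ⟨y, rfl⟩ := Ideal.Quotient.mk_surjective y
    obtain ⟨c, hc⟩ := hres y
    refine ⟨c, ?_⟩
    rw [hmax, Ideal.mem_span_pair] at hc
    obtain ⟨u, v, huv⟩ := hc
    have h1 : Ideal.Quotient.mk I y - algebraMap K _ c = π (y - algebraMap K A c) := by
      rw [map_sub]; rfl
    rw [h1, ← huv, map_add, map_mul, map_mul, hx0, mul_zero, zero_add]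
    exact dvd_mul_left _ _
  have hnil : ¬ IsNilpotent (π l) := by
    rintro ⟨n, hn⟩
    exact hl n (hdvd.1 (by rw [map_pow, hn]))
  obtain ⟨m, u, hu, hgu⟩ := exists_eq_unit_mul_pow hmaxA (fun h => hg (hdvd.1 h))
  obtain ⟨hfin, hrank⟩ := finrank_quotient_span_pow hmaxA hnil hresA m
  have hspan : Ideal.span {π l ^ m} = (Ideal.span {g}).map (Ideal.Quotient.mkₐ K I) := by
    rw [Ideal.map_span, Set.image_singleton]
    change _ = Ideal.span {π g}
    rw [hgu, mul_comm, Ideal.span_singleton_mul_right_unit hu]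
  -- Modulo `x` the elements `g` and `l ^ m` generate the same ideal, so the double quotient is `A /
  -- (x, g)`.
  have hsup : I ⊔ Ideal.span {g} = Ideal.span {x, g} := (Ideal.span_insert _ _).symm
  let E : ((A ⧸ I) ⧸ Ideal.span {π l ^ m}) ≃ₐ[K] (A ⧸ Ideal.span {x, g}) :=
    (Ideal.quotientEquivAlgOfEq K hspan).trans
      ((DoubleQuot.quotQuotEquivQuotSupₐ K I (Ideal.span {g})).trans
        (Ideal.quotientEquivAlgOfEq K hsup))
  obtain ⟨U, rfl⟩ := Ideal.Quotient.mk_surjective u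
  refine ⟨m, U, isUnit_of_map_unit π U hu, hdvd.1 ?_, Module.Finite.equiv E.toLinearEquiv, ?_⟩
  · rw [map_sub, hgu, map_mul, map_pow, sub_self]
  · rw [← hrank]; exact E.symm.toLinearEquiv.finrank_eq

end PrincipalMaximalIdeal

/-! ### The local ring of a plane curve at a regular point -/

section LocalRing

variable {K : Type*} [Field K]

theorem mem_pointIdeal {a : Fin 2 → K} {p : MvPolynomial (Fin 2) K} :
    p ∈ pointIdeal a ↔ eval a p = 0 := RingHom.mem_ker

theorem X_sub_C_mem_pointIdeal (a : Fin 2 → K) (i : Fin 2) : X i - C (a i) ∈ pointIdeal a := by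
  simp [mem_pointIdeal]

theorem pointIdeal_eq_span (a : Fin 2 → K) :
    pointIdeal a = Ideal.span {X 0 - C (a 0), X 1 - C (a 1)} := by
  apply le_antisymm
  · have h (p : MvPolynomial (Fin 2) K) :
        p - C (eval a p) ∈ Ideal.span {X 0 - C (a 0), X 1 - C (a 1)} := by
      induction p using MvPolynomial.induction_on with
      | C c => simp
      | add p q hp hq =>
        have := add_mem hp hq
        rw [map_add, C_add]
        convert this using 1
        ring
      | mul_X p i hp =>
        have hX : X i - C (a i) ∈ (Ideal.span {X 0 - C (a 0), X 1 - C (a 1)} :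
            Ideal (MvPolynomial (Fin 2) K)) :=
          Ideal.subset_span (by fin_cases i <;> simp)
        have := add_mem (Ideal.mul_mem_left _ p hX) (Ideal.mul_mem_right (C (a i)) _ hp)
        rw [map_mul, C_mul, eval_X]
        convert this using 1
        ring
    intro p hp
    have := h p
    rwa [mem_pointIdeal.1 hp, C_0, sub_zero] at this
  · rw [Ideal.span_le]
    rintro p (rfl | rfl)
    · exact X_sub_C_mem_pointIdeal a 0
    · exact X_sub_C_mem_pointIdeal a 1

/-- First-order Taylor expansion. -/
theorem sub_taylor_mem_pointIdeal_sq (a : Fin 2 → K) (p : MvPolynomial (Fin 2) K) :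
    p - C (eval a p) - ∑ i, C (eval a (pderiv i p)) * (X i - C (a i)) ∈ pointIdeal a ^ 2 := by
  induction p using MvPolynomial.induction_on with
  | C c => simp
  | add p q hp hq =>
    have := add_mem hp hq
    simp only [Fin.sum_univ_two, map_add] at this ⊢
    convert this using 1
    ring
  | mul_X p i hp =>
    have h1 : (p - C (eval a p)) * (X i - C (a i)) ∈ pointIdeal a ^ 2 := by
      rw [pow_two]
      exact Ideal.mul_mem_mul (by simp [mem_pointIdeal]) (X_sub_C_mem_pointIdeal a i)
    have := add_mem h1 (Ideal.mul_mem_right (C (a i)) _ hp)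
    simp only [Fin.sum_univ_two, pderiv_mul, map_add, map_mul, eval_X,
      pderiv_X] at this ⊢
    convert this using 1
    fin_cases i <;> simp <;> ring

/-- The affine linear form through `a` vanishing in the direction `τ`. -/
def tangentForm (a τ : Fin 2 → K) : MvPolynomial (Fin 2) K :=
  C (τ 1) * (X 0 - C (a 0)) - C (τ 0) * (X 1 - C (a 1))

theorem eval_tangentForm (a τ y : Fin 2 → K) :
    eval y (tangentForm a τ) = τ 1 * (y 0 - a 0) - τ 0 * (y 1 - a 1) := by
  simp [tangentForm]

variable {a τ : Fin 2 → K} {F G : MvPolynomial (Fin 2) K}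

/-- Modulo the square of the maximal ideal, `F` and `tangentForm a τ` are linear forms whose
determinant is, up to sign, the derivative of `F` along `τ`. Being independent, they generate by
Nakayama. Here `τ` is transversal to the curve, so `tangentForm` restricts to a local parameter on
it. -/
theorem maximalIdeal_eq_span (hF : eval a F = 0) (hτ : ∑ i, τ i * eval a (pderiv i F) ≠ 0) :
    IsLocalRing.maximalIdeal (Localization.AtPrime (pointIdeal a)) =
      Ideal.span {algebraMap _ _ F, algebraMap _ _ (tangentForm a τ)} := by
  set φ := algebraMap (MvPolynomial (Fin 2) K) (Localization.AtPrime (pointIdeal a)) with hφ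
  have hmap : IsLocalRing.maximalIdeal (Localization.AtPrime (pointIdeal a)) =
      (pointIdeal a).map φ := (Localization.AtPrime.map_eq_maximalIdeal).symm
  have hmem {p : MvPolynomial (Fin 2) K} (hp : p ∈ pointIdeal a) :
      φ p ∈ IsLocalRing.maximalIdeal (Localization.AtPrime (pointIdeal a)) := by
    rw [hmap]; exact Ideal.mem_map_of_mem φ hp
  apply le_antisymm
  · set m := IsLocalRing.maximalIdeal (Localization.AtPrime (pointIdeal a)) with hm
    refine Submodule.le_of_le_smul_of_le_jacobson_bot (I := m) (IsNoetherian.noetherian _)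
      (IsLocalRing.maximalIdeal_le_jacobson _) ?_
    set N := Ideal.span {φ F, φ (tangentForm a τ)} ⊔ m • m with hN
    set D := ∑ i, τ i * eval a (pderiv i F) with hD
    have hsq {p : MvPolynomial (Fin 2) K} (hp : p ∈ pointIdeal a ^ 2) : φ p ∈ N := by
      refine Ideal.mem_sup_right ?_
      rw [smul_eq_mul, ← pow_two, hmap, ← Ideal.map_pow]
      exact Ideal.mem_map_of_mem φ hp
    have hFN : φ F ∈ N := Ideal.mem_sup_left (Ideal.subset_span (by simp))
    have hLN : φ (tangentForm a τ) ∈ N := Ideal.mem_sup_left (Ideal.subset_span (by simp))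
    have hT := sub_taylor_mem_pointIdeal_sq a F
    rw [hF, C_0, sub_zero, Fin.sum_univ_two] at hT
    rw [Fin.sum_univ_two] at hD
    have hinv {p : MvPolynomial (Fin 2) K} (hp : φ (C D * p) ∈ N) : φ p ∈ N := by
      have := Ideal.mul_mem_left N (φ (C D⁻¹)) hp
      rwa [← map_mul, ← mul_assoc, ← C_mul, inv_mul_cancel₀ hτ, C_1, one_mul] at this
    rw [hmap, Ideal.map_le_iff_le_comap]
    refine (pointIdeal_eq_span a).le.trans (Ideal.span_le.2 ?_)
    rintro p (rfl | rfl)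
    -- Cramer's rule: to first order `τ₀ F + ∂₁F · L = D (X₀ - a₀)`, with `L` the tangent form; the
    -- other coordinate is similar.
    · refine hinv ?_
      have h1 := Ideal.mul_mem_left N (φ (C (τ 0))) hFN
      have h2 := Ideal.mul_mem_left N (φ (C (eval a (pderiv 1 F)))) hLN
      have h3 := Ideal.mul_mem_left N (φ (C (τ 0))) (hsq hT)
      have h4 := sub_mem (add_mem h1 h2) h3
      simp only [← map_mul, ← map_sub, ← map_add] at h4
      convert h4 using 2
      rw [hD, tangentForm]
      simp only [C_add, C_mul]
      ring
    · refine hinv ?_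
      have h1 := Ideal.mul_mem_left N (φ (C (τ 1))) hFN
      have h2 := Ideal.mul_mem_left N (φ (C (eval a (pderiv 0 F)))) hLN
      have h3 := Ideal.mul_mem_left N (φ (C (τ 1))) (hsq hT)
      have h4 := sub_mem (sub_mem h1 h2) h3
      simp only [← map_mul, ← map_sub] at h4
      convert h4 using 2
      rw [hD, tangentForm]
      simp only [C_add, C_mul]
      ring
  · rw [Ideal.span_le]
    rintro p (rfl | rfl)
    · exact hmem (mem_pointIdeal.2 hF)
    · exact hmem (mem_pointIdeal.2 (by simp [eval_tangentForm]))

theorem exists_sub_algebraMap_mem_maximalIdeal (y : Localization.AtPrime (pointIdeal a)) :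
    ∃ c : K, y - algebraMap K _ c ∈
      IsLocalRing.maximalIdeal (Localization.AtPrime (pointIdeal a)) := by
  obtain ⟨p, s, rfl⟩ := IsLocalization.exists_mk'_eq (pointIdeal a).primeCompl y
  have hs : eval a (s : MvPolynomial (Fin 2) K) ≠ 0 := fun h => s.2 (mem_pointIdeal.2 h)
  refine ⟨eval a p / eval a s, ?_⟩
  rw [IsScalarTower.algebraMap_apply K (MvPolynomial (Fin 2) K), algebraMap_eq,
    ← IsLocalization.mk'_one (M := (pointIdeal a).primeCompl), ← IsLocalization.mk'_sub,
    IsLocalization.AtPrime.mk'_mem_maximal_iff _ (pointIdeal a), mem_pointIdeal]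
  simp [div_mul_cancel₀ _ hs]

/-- The structure of the intersection of `F` and `G` at a regular point of `F`: in the local ring
of `F`, the polynomial `G` is a unit times a power of a parameter. -/
theorem exists_unit_mul_tangentForm_pow (hF : eval a F = 0)
    (hτ : ∑ i, τ i * eval a (pderiv i F) ≠ 0)
    (hL : ∀ (n : ℕ) (s b : MvPolynomial (Fin 2) K), eval a s ≠ 0 →
      s * tangentForm a τ ^ n ≠ b * F)
    (hG : ∀ s b : MvPolynomial (Fin 2) K, eval a s ≠ 0 → s * G ≠ b * F) :
    ∃ (m : ℕ) (s w b : MvPolynomial (Fin 2) K), eval a s ≠ 0 ∧ eval a w ≠ 0 ∧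
      s * G = w * tangentForm a τ ^ m + b * F ∧
      Module.Finite K (Localization.AtPrime (pointIdeal a) ⧸ (Ideal.span {F, G}).map
        (algebraMap (MvPolynomial (Fin 2) K) (Localization.AtPrime (pointIdeal a)))) ∧
      affineIntersectionMultiplicity F G a = m := by
  set φ := algebraMap (MvPolynomial (Fin 2) K) (Localization.AtPrime (pointIdeal a)) with hφ
  -- Divisibility by `F` in the local ring, with denominators cleared; the hypotheses `hL` and `hG`
  -- negate exactly this form.
  have hmemI {p : MvPolynomial (Fin 2) K} (hp : φ F ∣ φ p) :
      ∃ s b : MvPolynomial (Fin 2) K, eval a s ≠ 0 ∧ s * p = b * F := by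
    have h1 : φ p ∈ (Ideal.span {F}).map φ := by
      rw [Ideal.map_span, Set.image_singleton]
      exact Ideal.mem_span_singleton.2 hp
    rw [IsLocalization.algebraMap_mem_map_algebraMap_iff (pointIdeal a).primeCompl] at h1
    obtain ⟨s, hs, hsp⟩ := h1
    obtain ⟨b, hb⟩ := Ideal.mem_span_singleton'.1 hsp
    exact ⟨s, b, fun h => hs (mem_pointIdeal.2 h), hb.symm⟩
  obtain ⟨m, u, hu, hdvd, hfin, hrank⟩ := exists_unit_mul_pow_mod (K := K) (g := φ G)
    (maximalIdeal_eq_span hF hτ) exists_sub_algebraMap_mem_maximalIdeal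
    (fun n hn => by
      rw [← map_pow] at hn
      obtain ⟨s, b, hs, hsb⟩ := hmemI hn
      exact hL n s b hs hsb)
    (fun h => by
      obtain ⟨s, b, hs, hsb⟩ := hmemI h
      exact hG s b hs hsb)
  have hspan : Ideal.span {φ F, φ G} = (Ideal.span {F, G}).map φ := by
    rw [Ideal.map_span, Set.image_pair]
  rw [hspan] at hfin hrank
  obtain ⟨p, s, rfl⟩ := IsLocalization.exists_mk'_eq (pointIdeal a).primeCompl u
  have hs : eval a (s : MvPolynomial (Fin 2) K) ≠ 0 := fun h => s.2 (mem_pointIdeal.2 h)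
  have hp : eval a p ≠ 0 := fun h =>
    (IsLocalRing.mem_maximalIdeal _).1 ((IsLocalization.AtPrime.mk'_mem_maximal_iff
      (Localization.AtPrime (pointIdeal a)) (pointIdeal a) p s).2 (mem_pointIdeal.2 h)) hu
  have hsG : φ F ∣ φ (s * G - p * tangentForm a τ ^ m) := by
    have h1 : φ (s * G - p * tangentForm a τ ^ m) = φ s * (φ G - IsLocalization.mk'
        (Localization.AtPrime (pointIdeal a)) p s * φ (tangentForm a τ) ^ m) := by
      rw [map_sub, map_mul, map_mul, map_pow,
        ← IsLocalization.mk'_spec (Localization.AtPrime (pointIdeal a)) p s]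
      ring
    rw [h1]
    exact hdvd.mul_left _
  obtain ⟨s', b, hs', hsb⟩ := hmemI hsG
  refine ⟨m, s' * s, s' * p, b, ?_, ?_, ?_, hfin, hrank⟩
  · rw [map_mul]; exact mul_ne_zero hs' hs
  · rw [map_mul]; exact mul_ne_zero hs' hp
  · linear_combination hsb

end LocalRing

/-! ### Real affine plane curves near a regular point -/

section RealAffine

open Filter Topology

variable {a τ : Fin 2 → ℝ} {F G H : MvPolynomial (Fin 2) ℝ}

theorem hasDerivAt_eval_line {σ : Type*} [Fintype σ] [DecidableEq σ] (F : MvPolynomial σ ℝ)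
    (τ a : σ → ℝ) : HasDerivAt (fun t : ℝ => eval (t • τ + a) F) (eval a (dirDeriv τ F)) 0 := by
  have h := (aeval (fun i => Polynomial.C (τ i) * Polynomial.X + Polynomial.C (a i)) F).hasDerivAt 0
  rw [derivative_aeval_line, eval_aeval_line] at h
  simpa [eval_aeval_line] using h

theorem sq_add_sq_pos_of_eval_dirDeriv_ne_zero (hτ : eval a (dirDeriv τ F) ≠ 0) :
    0 < τ 0 ^ 2 + τ 1 ^ 2 := by
  by_contra hc
  have h0 : τ 0 = 0 := by nlinarith [sq_nonneg (τ 0), sq_nonneg (τ 1)]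
  have h1 : τ 1 = 0 := by nlinarith [sq_nonneg (τ 0), sq_nonneg (τ 1)]
  exact hτ (by simp [eval_dirDeriv, h0, h1])

/-- Near a regular point of a real curve, the curve has points on all nearby parallels to a
transversal direction. -/
theorem eventually_exists_eval_tangentForm_eq (hF : eval a F = 0)
    (hτ : eval a (dirDeriv τ F) ≠ 0) {U : Set (Fin 2 → ℝ)} (hU : U ∈ 𝓝 a) :
    ∀ᶠ s in 𝓝 (0 : ℝ), ∃ y ∈ U, eval y F = 0 ∧
      eval y (tangentForm a τ) = s * (τ 0 ^ 2 + τ 1 ^ 2) := by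
  -- `t` moves along `τ` and `s` along its normal, where the tangent form equals `s (τ₀² + τ₁²)`. At
  -- `s = 0`, `F` changes sign across `t = 0`; the signs at `t = ±δ` persist for small `s`, which
  -- gives a zero of `F` on each nearby parallel.
  set P : ℝ → ℝ → Fin 2 → ℝ := fun s t => t • τ + (s • ![τ 1, -τ 0] + a) with hP
  have hPc : Continuous fun z : ℝ × ℝ => P z.1 z.2 := by simp only [hP]; fun_prop
  have hU' : ∀ᶠ z in 𝓝 ((0 : ℝ), (0 : ℝ)), P z.1 z.2 ∈ U :=
    (hPc.tendsto (0, 0)).eventually (by simp only [hP, zero_smul, zero_add]; exact hU)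
  obtain ⟨r, hr, hball⟩ := Metric.eventually_nhds_iff.1 hU'
  have hd := hasDerivAt_eval_line F τ a
  set c := eval a (dirDeriv τ F) with hc
  have hsign : ∀ᶠ t in 𝓝[≠] (0 : ℝ), 0 < (t⁻¹ * eval (t • τ + a) F) * c := by
    have h1 := hd.tendsto_slope_zero
    simp only [zero_add, zero_smul, hF, sub_zero, smul_eq_mul] at h1
    exact (h1.mul_const c).eventually (lt_mem_nhds (mul_self_pos.2 hτ))
  have hneg : Tendsto (fun t : ℝ => -t) (𝓝[>] 0) (𝓝[≠] 0) := by
    refine tendsto_nhdsWithin_iff.2 ⟨?_, ?_⟩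
    · have : Continuous fun t : ℝ => -t := by fun_prop
      simpa using (this.tendsto 0).mono_left nhdsWithin_le_nhds
    · filter_upwards [self_mem_nhdsWithin] with t ht
      simpa using (ne_of_gt ht)
  have hpos : 𝓝[>] (0 : ℝ) ≤ 𝓝[≠] 0 := nhdsWithin_mono _ fun t ht => ne_of_gt ht
  obtain ⟨δ, ⟨h1, h2⟩, hδ0, hδr⟩ := ((hsign.filter_mono hpos).and (hneg.eventually hsign)).and
    (Ioo_mem_nhdsGT hr) |>.exists
  have hmul : eval (P 0 (-δ)) F * eval (P 0 δ) F < 0 := by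
    simp only [hP, zero_smul, zero_add]
    have hc2 : 0 < c ^ 2 := by positivity
    have h3 := mul_pos h1 h2
    rw [inv_neg] at h3
    have h4 : δ⁻¹ * eval (δ • τ + a) F * c * (-δ⁻¹ * eval (-δ • τ + a) F * c) =
      -(eval (-δ • τ + a) F * eval (δ • τ + a) F) * (δ⁻¹ ^ 2 * c ^ 2) := by ring
    rw [h4] at h3
    have h5 : 0 < δ⁻¹ ^ 2 * c ^ 2 := by positivity
    have := (pos_iff_pos_of_mul_pos h3).2 h5
    linarith
  have hFc (t : ℝ) : Continuous fun s => eval (P s t) F :=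
    (continuous_eval F).comp (hPc.comp (by fun_prop : Continuous fun s : ℝ => (s, t)))
  have hmul' : ∀ᶠ s in 𝓝 (0 : ℝ), eval (P s (-δ)) F * eval (P s δ) F < 0 :=
    (((hFc (-δ)).mul (hFc δ)).tendsto 0).eventually (gt_mem_nhds hmul)
  filter_upwards [hmul', Metric.ball_mem_nhds (0 : ℝ) hr] with s hs hsr
  have hcont : ContinuousOn (fun t => eval (P s t) F) (Set.Icc (-δ) δ) :=
    ((continuous_eval F).comp
      (hPc.comp (by fun_prop : Continuous fun t : ℝ => (s, t)))).continuousOn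
  have hle : -δ ≤ δ := by linarith
  obtain ⟨t, ht, ht0⟩ : ∃ t ∈ Set.Ioo (-δ) δ, eval (P s t) F = 0 := by
    rcases mul_neg_iff.1 hs with ⟨ha, hb⟩ | ⟨ha, hb⟩
    · exact intermediate_value_Ioo' hle hcont ⟨hb, ha⟩
    · exact intermediate_value_Ioo hle hcont ⟨ha, hb⟩
  refine ⟨P s t, hball (y := (s, t)) ?_, ht0, ?_⟩
  · rw [Prod.dist_eq, max_lt_iff]
    refine ⟨hsr, ?_⟩
    rw [Real.dist_eq, sub_zero, abs_lt]
    exact ⟨by linarith [ht.1], by linarith [ht.2]⟩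
  · rw [eval_tangentForm]
    simp only [hP, Pi.add_apply, Pi.smul_apply, smul_eq_mul, Matrix.cons_val_zero,
      Matrix.cons_val_one]
    ring

/-- The zero line of the tangent form is `a + ℝτ`, along which `F` has nonzero derivative at `a`; so
`a` is an isolated zero of `F` there. -/
theorem eventually_eq_of_eval_eq_zero (hτ : eval a (dirDeriv τ F) ≠ 0) :
    ∀ᶠ y in 𝓝 a, eval y F = 0 → eval y (tangentForm a τ) = 0 → y = a := by
  have hpos := sq_add_sq_pos_of_eval_dirDeriv_ne_zero hτ
  have h1 := (hasDerivAt_eval_line F τ a).eventually_ne (c := 0) hτ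
  rw [eventually_nhdsWithin_iff] at h1
  set θ : (Fin 2 → ℝ) → ℝ :=
    fun y => (τ 0 * (y 0 - a 0) + τ 1 * (y 1 - a 1)) / (τ 0 ^ 2 + τ 1 ^ 2) with hθ
  have hθc : Continuous θ := by simp only [hθ]; fun_prop
  have hθa : Tendsto θ (𝓝 a) (𝓝 0) := by simpa [hθ] using hθc.tendsto a
  filter_upwards [hθa.eventually h1] with y hy hFy hLy
  rw [eval_tangentForm] at hLy
  have hya : y = θ y • τ + a := by
    ext j
    simp only [hθ, Pi.add_apply, Pi.smul_apply, smul_eq_mul]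
    rw [div_mul_eq_mul_div, ← sub_eq_iff_eq_add, eq_div_iff hpos.ne']
    fin_cases j
    · simp only [Fin.zero_eta]
      linear_combination (τ 1) * hLy
    · simp only [Fin.mk_one]
      linear_combination (-τ 0) * hLy
  by_contra hne
  refine hy (fun h0 => hne ?_) (by rwa [← hya])
  have h0 : θ y = 0 := h0
  rw [hya, h0, zero_smul, zero_add]

/-- The local structure of the intersection of real curves at a regular point of `F` at which `G`
does not vanish identically on `F`. -/
theorem intersection_at_regular_point (hF : eval a F = 0) (hτ : eval a (dirDeriv τ F) ≠ 0)
    (hG : ∀ s b : MvPolynomial (Fin 2) ℝ, eval a s ≠ 0 → s * G ≠ b * F) :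
    Module.Finite ℝ (Localization.AtPrime (pointIdeal a) ⧸ (Ideal.span {F, G}).map
        (algebraMap (MvPolynomial (Fin 2) ℝ) (Localization.AtPrime (pointIdeal a)))) ∧
      (∀ᶠ y in 𝓝 a, eval y F = 0 → eval y G = 0 → y = a) ∧
      ∀ c : ℝ, c ≠ 0 → (∀ᶠ y in 𝓝 a, eval y F = 0 → 0 ≤ c * eval y G) →
        Even (affineIntersectionMultiplicity F G a) := by
  have hpos := sq_add_sq_pos_of_eval_dirDeriv_ne_zero hτ
  have hne {s : MvPolynomial (Fin 2) ℝ} (hs : eval a s ≠ 0) :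
      ∀ᶠ y in 𝓝 a, 0 < eval y s * eval a s :=
    (((continuous_eval s).mul continuous_const).tendsto a).eventually
      (lt_mem_nhds (mul_self_pos.2 hs))
  have hpts {U : Set (Fin 2 → ℝ)} (hU : U ∈ 𝓝 a) :
      (∃ y ∈ U, eval y F = 0 ∧ 0 < eval y (tangentForm a τ)) ∧
        ∃ y ∈ U, eval y F = 0 ∧ eval y (tangentForm a τ) < 0 := by
    have h := eventually_exists_eval_tangentForm_eq hF hτ hU
    constructor
    · obtain ⟨s, ⟨y, hy, hy0, hys⟩, hs⟩ := ((h.filter_mono nhdsWithin_le_nhds).and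
        (self_mem_nhdsWithin (s := Set.Ioi 0))).exists
      exact ⟨y, hy, hy0, hys ▸ mul_pos hs hpos⟩
    · obtain ⟨s, ⟨y, hy, hy0, hys⟩, hs⟩ := ((h.filter_mono nhdsWithin_le_nhds).and
        (self_mem_nhdsWithin (s := Set.Iio 0))).exists
      exact ⟨y, hy, hy0, hys ▸ mul_neg_of_neg_of_pos hs hpos⟩
  -- No power of the tangent form is locally divisible by `F`, since the real curve has points
  -- arbitrarily near `a` where that form is positive.
  obtain ⟨m, s, w, b, hs, hw, hsG, hfin, hm⟩ := exists_unit_mul_tangentForm_pow hF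
    (by rwa [← eval_dirDeriv]) (fun n s b hs hsb => by
      obtain ⟨⟨y, hy, hFy, hLy⟩, -⟩ := hpts (hne hs)
      have h1 := congrArg (eval y) hsb
      rw [map_mul, map_mul, map_pow, hFy, mul_zero] at h1
      exact mul_ne_zero (left_ne_zero_of_mul (ne_of_gt hy)) (pow_ne_zero n hLy.ne') h1) hG
  have hev (y : Fin 2 → ℝ) (hy : eval y F = 0) :
      eval y s * eval y G = eval y w * eval y (tangentForm a τ) ^ m := by
    have h1 := congrArg (eval y) hsG
    simpa [hy] using h1
  refine ⟨hfin, ?_, fun c hc hcG => ?_⟩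
  · filter_upwards [hne hw, eventually_eq_of_eval_eq_zero hτ] with y hwy hy hFy hGy
    refine hy hFy ?_
    have h1 := hev y hFy
    rw [hGy, mul_zero, eq_comm] at h1
    exact eq_zero_of_pow_eq_zero
      ((mul_eq_zero.1 h1).resolve_left (left_ne_zero_of_mul (ne_of_gt hwy)))
  · rw [hm]
    -- With `m` odd, `G` would take opposite signs at nearby points on the two sides of `a` along
    -- the curve.
    by_contra hodd
    rw [Nat.not_even_iff_odd] at hodd
    obtain ⟨⟨y, ⟨⟨hsy, hwy⟩, hcy⟩, hFy, hLy⟩, z, ⟨⟨hsz, hwz⟩, hcz⟩, hFz, hLz⟩ :=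
      hpts (((hne hs).and (hne hw)).and hcG)
    have key (y : Fin 2 → ℝ) (hsy : 0 < eval y s * eval a s) (hFy : eval y F = 0)
        (hcy : 0 ≤ c * eval y G) :
        0 ≤ (c * eval a s * eval a w) * (eval y w * eval a w) *
          eval y (tangentForm a τ) ^ m := by
      have h2 := mul_nonneg (mul_nonneg hsy.le hcy) (sq_nonneg (eval a w))
      have h3 := hev y hFy
      have : (c * eval a s * eval a w) * (eval y w * eval a w) * eval y (tangentForm a τ) ^ m =
          eval y s * eval a s * (c * eval y G) * eval a w ^ 2 := by
        linear_combination (-c * eval a s * eval a w ^ 2) * h3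
      rwa [this]
    have h1 := key y hsy hFy (hcy hFy)
    have h2 := key z hsz hFz (hcz hFz)
    have h3 := hodd.pow_neg hLz
    have h4 : 0 < eval y (tangentForm a τ) ^ m := pow_pos hLy m
    have hk : c * eval a s * eval a w ≠ 0 := mul_ne_zero (mul_ne_zero hc hs) hw
    rcases lt_or_gt_of_ne hk with hk | hk
    · exact absurd h1 (not_le.2 (mul_neg_of_neg_of_pos (mul_neg_of_neg_of_pos hk hwy) h4))
    · exact absurd h2 (not_le.2 (mul_neg_of_pos_of_neg (mul_pos hk hwz) h3))

/-- Clearing denominators, `sH = uF + vG` with `s(a) ≠ 0`, so on the curve `H = (v/s) G` with `v/s`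
bounded near `a`. -/
theorem eventually_abs_eval_le_of_mem
    (hH : algebraMap _ (Localization.AtPrime (pointIdeal a)) H ∈ (Ideal.span {F, G}).map
      (algebraMap (MvPolynomial (Fin 2) ℝ) (Localization.AtPrime (pointIdeal a)))) :
    ∃ C : ℝ, ∀ᶠ y in 𝓝 a, eval y F = 0 → |eval y H| ≤ C * |eval y G| := by
  rw [IsLocalization.algebraMap_mem_map_algebraMap_iff (pointIdeal a).primeCompl] at hH
  obtain ⟨s, hs, hsH⟩ := hH
  obtain ⟨u, v, huv⟩ := Ideal.mem_span_pair.1 hsH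
  have hs : eval a s ≠ 0 := fun h => hs (mem_pointIdeal.2 h)
  have hcont : ContinuousAt (fun y => |eval y v / eval y s|) a :=
    ((continuous_eval v).continuousAt.div (continuous_eval s).continuousAt hs).abs
  refine ⟨|eval a v / eval a s| + 1, ?_⟩
  filter_upwards [hcont.eventually (gt_mem_nhds (lt_add_one _)),
    (continuous_eval s).continuousAt.eventually_ne hs] with y hy hsy hFy
  have h1 := congrArg (eval y) huv
  simp only [map_add, map_mul, hFy, mul_zero, zero_add] at h1
  have h2 : eval y H = eval y v / eval y s * eval y G := by
    field_simp
    linarith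
  rw [h2, abs_mul]
  exact mul_le_mul_of_nonneg_right hy.le (abs_nonneg _)

end RealAffine

/-! ### Affine charts -/

section Charts

variable {K : Type*} [Field K]

/-- The affine coordinates of a point in the `i`-th standard chart. -/
def affinePoint (i : Fin 3) (x : Fin 3 → K) : Fin 2 → K := fun j => x (i.succAbove j) / x i

/-- The point of the plane `x i = 1` with given affine coordinates. -/
def liftPoint (i : Fin 3) (y : Fin 2 → K) : Fin 3 → K := i.insertNth (1 : K) y

@[simp] theorem liftPoint_self (i : Fin 3) (y : Fin 2 → K) : liftPoint i y i = 1 := by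
  simp [liftPoint]

@[simp] theorem liftPoint_succAbove (i : Fin 3) (y : Fin 2 → K) (j : Fin 2) :
    liftPoint i y (i.succAbove j) = y j := by
  simp [liftPoint]

theorem liftPoint_affinePoint {i : Fin 3} {x : Fin 3 → K} (hx : x i ≠ 0) :
    liftPoint i (affinePoint i x) = (x i)⁻¹ • x := by
  ext k
  rcases Fin.eq_self_or_eq_succAbove i k with rfl | ⟨j, rfl⟩
  · simp [hx]
  · simp [affinePoint, div_eq_inv_mul]

theorem affinePoint_smul (i : Fin 3) {c : K} (hc : c ≠ 0) (x : Fin 3 → K) :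
    affinePoint i (c • x) = affinePoint i x := by
  ext j
  simp [affinePoint, mul_div_mul_left _ _ hc]

theorem affinePoint_liftPoint (i : Fin 3) (y : Fin 2 → K) : affinePoint i (liftPoint i y) = y := by
  ext j
  simp [affinePoint]

/-- Dehomogenization as a homomorphism of algebras. -/
def dehomogenizeHom (i : Fin 3) : MvPolynomial (Fin 3) K →ₐ[K] MvPolynomial (Fin 2) K :=
  aeval (i.insertNth (1 : MvPolynomial (Fin 2) K) (X : Fin 2 → MvPolynomial (Fin 2) K) :
    Fin 3 → MvPolynomial (Fin 2) K)

theorem dehomogenizeHom_apply (i : Fin 3) (f : MvPolynomial (Fin 3) K) :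
    dehomogenizeHom i f = dehomogenize i f := rfl

@[simp] theorem dehomogenizeHom_X_self (i : Fin 3) : dehomogenizeHom (K := K) i (X i) = 1 := by
  rw [dehomogenizeHom, aeval_X, Fin.insertNth_apply_same]

@[simp] theorem dehomogenizeHom_X_succAbove (i : Fin 3) (j : Fin 2) :
    dehomogenizeHom (K := K) i (X (i.succAbove j)) = X j := by
  rw [dehomogenizeHom, aeval_X, Fin.insertNth_apply_succAbove]

theorem eval_dehomogenize (i : Fin 3) (f : MvPolynomial (Fin 3) K) (y : Fin 2 → K) :
    eval y (dehomogenize i f) = eval (liftPoint i y) f := by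
  rw [← dehomogenizeHom_apply]
  induction f using MvPolynomial.induction_on with
  | C a => simp [algHom_C]
  | add p q hp hq => simp [hp, hq]
  | mul_X p k hp =>
    rcases Fin.eq_self_or_eq_succAbove i k with rfl | ⟨j, rfl⟩ <;> simp [hp]

theorem eval_dehomogenize_affinePoint {f : MvPolynomial (Fin 3) K} {d : ℕ}
    (hf : f.IsHomogeneous d) {i : Fin 3} {x : Fin 3 → K} (hx : x i ≠ 0) :
    eval (affinePoint i x) (dehomogenize i f) = (x i)⁻¹ ^ d * eval x f := by
  rw [eval_dehomogenize, liftPoint_affinePoint hx, eval_smul_of_isHomogeneous hf]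

theorem pderiv_dehomogenize (i : Fin 3) (j : Fin 2) (f : MvPolynomial (Fin 3) K) :
    pderiv j (dehomogenize i f) = dehomogenize i (pderiv (i.succAbove j) f) := by
  simp only [← dehomogenizeHom_apply]
  induction f using MvPolynomial.induction_on with
  | C a => simp [algHom_C, algebraMap_eq]
  | add p q hp hq => simp [hp, hq]
  | mul_X p k hp =>
    rcases Fin.eq_self_or_eq_succAbove i k with rfl | ⟨l, rfl⟩
    · simp [hp, pderiv_X_of_ne (Fin.succAbove_ne _ _).symm]
    · by_cases hl : l = j
      · subst hl
        simp [hp]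
      · have h1 : i.succAbove l ≠ i.succAbove j := fun h => hl (Fin.succAbove_right_injective h)
        simp [hp, pderiv_X_of_ne hl, pderiv_X_of_ne h1]

theorem exists_homogenization (i : Fin 3) (s : MvPolynomial (Fin 2) K) :
    ∃ (N : ℕ) (S : MvPolynomial (Fin 3) K), ∀ x : Fin 3 → K, x i ≠ 0 →
      eval x S = x i ^ N * eval (affinePoint i x) s := by
  induction s using MvPolynomial.induction_on with
  | C a => exact ⟨0, C a, fun x _ => by simp⟩
  | add p q hp hq =>
    obtain ⟨N, S, hS⟩ := hp
    obtain ⟨M, T, hT⟩ := hq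
    refine ⟨N + M, S * X i ^ M + T * X i ^ N, fun x hx => ?_⟩
    simp only [map_add, map_mul, map_pow, eval_X, hS x hx, hT x hx]
    ring
  | mul_X p j hp =>
    obtain ⟨N, S, hS⟩ := hp
    refine ⟨N + 1, S * X (i.succAbove j), fun x hx => ?_⟩
    have h1 : x (i.succAbove j) = x i * affinePoint i x j := (mul_div_cancel₀ _ hx).symm
    simp only [map_mul, eval_X, hS x hx, h1]
    ring

/-- The dehomogenization of an irreducible form does not divide the dehomogenization of a form of
smaller degree, even locally at a point. -/
theorem mul_dehomogenize_ne [Infinite K] {f g : MvPolynomial (Fin 3) K} {d k : ℕ}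
    (hf : f.IsHomogeneous d) (hg : g.IsHomogeneous k) (hkd : k < d) (hg0 : g ≠ 0)
    (hirr : Irreducible f) {i : Fin 3} {a : Fin 2 → K} (ha : eval a (dehomogenize i f) = 0)
    (s b : MvPolynomial (Fin 2) K) (hs : eval a s ≠ 0) :
    s * dehomogenize i g ≠ b * dehomogenize i f := by
  intro h
  have hprime : Prime f := hirr.prime
  obtain ⟨N, S, hS⟩ := exists_homogenization i s
  obtain ⟨M, B, hB⟩ := exists_homogenization i b
  have hx1 : eval (liftPoint i a) f = 0 := by rwa [← eval_dehomogenize]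
  have hX : ¬ f ∣ X i := by
    rintro ⟨q, hq⟩
    have := congrArg (eval (liftPoint i a)) hq
    simp [hx1] at this
  -- The extra factor `X i` makes both sides vanish on `x i = 0`, so agreement off that plane
  -- suffices for a polynomial identity over an infinite field.
  have hid : X i * (S * g * X i ^ (M + d)) = X i * (B * f * X i ^ (N + k)) := by
    refine MvPolynomial.funext fun x => ?_
    simp only [map_mul, map_pow, eval_X]
    by_cases hx : x i = 0
    · rw [hx, zero_mul, zero_mul]
    · have h1 := congrArg (eval (affinePoint i x)) h
      rw [map_mul, map_mul, eval_dehomogenize_affinePoint hf hx,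
        eval_dehomogenize_affinePoint hg hx] at h1
      rw [hS x hx, hB x hx]
      have hk : (x i)⁻¹ ^ k * x i ^ k = 1 := by rw [← mul_pow, inv_mul_cancel₀ hx, one_pow]
      have hd : (x i)⁻¹ ^ d * x i ^ d = 1 := by rw [← mul_pow, inv_mul_cancel₀ hx, one_pow]
      have h2 : eval (affinePoint i x) s * eval x g * x i ^ d =
          eval (affinePoint i x) b * eval x f * x i ^ k := by
        linear_combination (x i ^ d * x i ^ k) * h1 -
          eval (affinePoint i x) s * eval x g * x i ^ d * hk +
          eval (affinePoint i x) b * eval x f * x i ^ k * hd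
      calc _ = x i * x i ^ N * x i ^ M *
            (eval (affinePoint i x) s * eval x g * x i ^ d) := by ring
        _ = _ := by rw [h2]; ring
  have hdvd : f ∣ X i * (S * g * X i ^ (M + d)) := by
    rw [hid]; exact ⟨X i * (B * X i ^ (N + k)), by ring⟩
  -- The prime `f` vanishes at the lift of `a`, whereas `X i` and `S` do not; so `f` would have to
  -- divide `g`, which has smaller degree.
  rcases hprime.dvd_or_dvd hdvd with h1 | h1
  · exact hX h1
  rcases hprime.dvd_or_dvd h1 with h1 | h1
  · rcases hprime.dvd_or_dvd h1 with ⟨q, hq⟩ | ⟨q, hq⟩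
    · have h2 := congrArg (eval (liftPoint i a)) hq
      rw [map_mul, hx1, zero_mul, hS _ (by simp), affinePoint_liftPoint] at h2
      simp [hs] at h2
    · have h3 := totalDegree_mul_of_isDomain (left_ne_zero_of_mul (hq ▸ hg0))
        (right_ne_zero_of_mul (hq ▸ hg0))
      rw [← hq, hg.totalDegree hg0, hf.totalDegree hirr.ne_zero] at h3
      omega
  · exact hX (hprime.dvd_of_dvd_pow h1)

end Charts

/-- A direction in an affine chart corresponding to a direction in space. -/
def chartDirection (i : Fin 3) (a : Fin 2 → ℝ) (e : Fin 3 → ℝ) : Fin 2 → ℝ :=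
  fun j => e (i.succAbove j) - a j * e i

/-- Subtracting `e i` times the point itself moves `e` into the chart. By Euler's relation the
radial derivative vanishes at a zero of `f`, so the directional derivative is unchanged. -/
theorem eval_dirDeriv_dehomogenize {f : MvPolynomial (Fin 3) ℝ} {d : ℕ} (hf : f.IsHomogeneous d)
    (e : Fin 3 → ℝ) {i : Fin 3} {a : Fin 2 → ℝ} (ha : eval a (dehomogenize i f) = 0) :
    eval a (dirDeriv (chartDirection i a e) (dehomogenize i f)) =
      eval (liftPoint i a) (dirDeriv e f) := by
  have hE := congrArg (eval (liftPoint i a)) hf.sum_X_mul_pderiv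
  rw [eval_dehomogenize] at ha
  rw [map_nsmul, ha, smul_zero, map_sum, Fin.sum_univ_succAbove _ i] at hE
  simp only [map_mul, eval_X, liftPoint_self, liftPoint_succAbove, one_mul] at hE
  rw [eval_dirDeriv, eval_dirDeriv, Fin.sum_univ_succAbove _ i]
  simp only [pderiv_dehomogenize, eval_dehomogenize, chartDirection, sub_mul,
    Finset.sum_sub_distrib]
  have h1 : ∑ j, a j * e i * eval (liftPoint i a) (pderiv (i.succAbove j) f) =
      e i * ∑ j, a j * eval (liftPoint i a) (pderiv (i.succAbove j) f) := by
    rw [Finset.mul_sum]; exact Finset.sum_congr rfl fun j _ => by ring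
  rw [h1]
  linear_combination (-e i) * hE

/-! ### The dimension of the space of ternary forms -/

theorem le_finrank_homogeneousSubmodule (K : Type*) [Field K] (n : ℕ) :
    Module.Finite K (homogeneousSubmodule (Fin 3) K n) ∧
    (n + 2) * (n + 1) ≤ 2 * Module.finrank K (homogeneousSubmodule (Fin 3) K n) := by
  have hfin : Module.Finite K (homogeneousSubmodule (Fin 3) K n) :=
    Module.Finite.iff_fg.2 (homogeneousSubmodule_fg _ _ n)
  refine ⟨hfin, ?_⟩
  -- The exponents of `x^j y^(k-j) z^(n-k)` for `j ≤ k ≤ n`.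
  let μ : (Σ k : Fin (n + 1), Fin (k + 1)) → Fin 3 →₀ ℕ := fun p =>
    Finsupp.equivFunOnFinite.symm ![p.2, p.1 - p.2, n - p.1]
  have hμ (p) : (μ p).degree = n := by
    have h1 := p.1.2
    have h2 := p.2.2
    simp [μ, Finsupp.degree_eq_sum, Fin.sum_univ_three]
    omega
  have hinj : Function.Injective μ := by
    rintro ⟨⟨k, hk⟩, ⟨j, hj⟩⟩ ⟨⟨k', hk'⟩, ⟨j', hj'⟩⟩ h
    have h0 := DFunLike.congr_fun h 0
    have h1 := DFunLike.congr_fun h 1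
    simp only [μ, Finsupp.coe_equivFunOnFinite_symm, Matrix.cons_val_zero,
      Matrix.cons_val_one] at h0 h1
    dsimp only at hj hj'
    obtain rfl : j = j' := h0
    obtain rfl : k = k' := by omega
    rfl
  have hli : LinearIndependent K fun p => (⟨monomial (μ p) 1,
      isHomogeneous_monomial 1 (hμ p)⟩ : homogeneousSubmodule (Fin 3) K n) := by
    refine LinearIndependent.of_comp (Submodule.subtype _) ?_
    have := (basisMonomials (Fin 3) K).linearIndependent.comp μ hinj
    simpa [Function.comp_def] using this
  have hcard := hli.fintype_card_le_finrank
  have hsum : 2 * ∑ k : Fin (n + 1), ((k : ℕ) + 1) = (n + 2) * (n + 1) := by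
    rw [Fin.sum_univ_eq_sum_range (fun k => k + 1)]
    clear hcard hli hinj hμ μ hfin
    induction n with
    | zero => simp
    | succ n ih => rw [Finset.sum_range_succ, mul_add, ih]; ring
  rw [Fintype.card_sigma] at hcard
  simp only [Fintype.card_fin] at hcard
  omega

/-! ### Contact points of interlacers -/

/-- The affine coordinates of a point of the projective plane in its distinguished chart. -/
def chartPoint {K : Type*} [Field K] (p : Projectivization K (Fin 3 → K)) : Fin 2 → K :=
  affinePoint (chartIndex p) p.rep

theorem rep_chartIndex_ne_zero {K : Type*} [Field K] (p : Projectivization K (Fin 3 → K)) :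
    p.rep (chartIndex p) ≠ 0 :=
  (exists_rep_apply_ne_zero p).choose_spec

/-- The ideal generated by two curves in the local ring of the plane at `p`. -/
def localIdeal {K : Type*} [Field K] (f g : MvPolynomial (Fin 3) K)
    (p : Projectivization K (Fin 3 → K)) :
    Ideal (Localization.AtPrime (pointIdeal (chartPoint p))) :=
  (Ideal.span {dehomogenize (chartIndex p) f, dehomogenize (chartIndex p) g}).map
    (algebraMap (MvPolynomial (Fin 2) K) _)

/-- The local algebra of the intersection of two curves at `p`. -/
def LocalAlgebra {K : Type*} [Field K] (f g : MvPolynomial (Fin 3) K)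
    (p : Projectivization K (Fin 3 → K)) : Type _ :=
  Localization.AtPrime (pointIdeal (chartPoint p)) ⧸ localIdeal f g p

instance {K : Type*} [Field K] (f g : MvPolynomial (Fin 3) K)
    (p : Projectivization K (Fin 3 → K)) : CommRing (LocalAlgebra f g p) :=
  inferInstanceAs (CommRing (Localization.AtPrime (pointIdeal (chartPoint p)) ⧸ localIdeal f g p))

instance {K : Type*} [Field K] (f g : MvPolynomial (Fin 3) K)
    (p : Projectivization K (Fin 3 → K)) : Algebra K (LocalAlgebra f g p) :=
  inferInstanceAs
    (Algebra K (Localization.AtPrime (pointIdeal (chartPoint p)) ⧸ localIdeal f g p))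

/-- The image of a form in the local algebra of the intersection of two curves at `p`. -/
def toLocalAlgebra {K : Type*} [Field K] (f g : MvPolynomial (Fin 3) K)
    (p : Projectivization K (Fin 3 → K)) : MvPolynomial (Fin 3) K →ₗ[K] LocalAlgebra f g p :=
  (((Ideal.Quotient.mkₐ K (localIdeal f g p)).comp
    (IsScalarTower.toAlgHom K (MvPolynomial (Fin 2) K) _)).comp
      (dehomogenizeHom (chartIndex p))).toLinearMap

theorem mem_localIdeal_of_toLocalAlgebra_eq_zero {K : Type*} [Field K]
    {f g h : MvPolynomial (Fin 3) K} {p : Projectivization K (Fin 3 → K)}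
    (hh : toLocalAlgebra f g p h = 0) :
    algebraMap _ _ (dehomogenize (chartIndex p) h) ∈ localIdeal f g p :=
  Ideal.Quotient.eq_zero_iff_mem.1 hh

open Filter Topology in
theorem tendsto_affinePoint {i : Fin 3} {x : Fin 3 → ℝ} (hx : x i ≠ 0) :
    Tendsto (affinePoint i) (𝓝 x) (𝓝 (affinePoint i x)) :=
  tendsto_pi_nhds.2 fun j => ((continuous_apply (i.succAbove j)).tendsto x).div
    ((continuous_apply i).tendsto x) hx

section Interlacer

open Filter Topology

variable {d : ℕ} {f g h : MvPolynomial (Fin 3) ℝ} {e : Fin 3 → ℝ}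

theorem ne_zero_of_mem_interlacerCone (hg : g ∈ interlacerCone d f e) : g ≠ 0 := by
  rintro rfl
  simpa using hg.2.2

/-- The local structure of the intersection of a smooth hyperbolic curve with an interlacer. -/
theorem intersection_of_mem_interlacerCone (hd : 1 ≤ d) (hf : f.IsHomogeneous d)
    (hyp : IsHyperbolic f e) (hs : IsSmoothCurve f) (hg : g ∈ interlacerCone d f e)
    {p : Projectivization ℝ (Fin 3 → ℝ)} (hp : eval p.rep f = 0) :
    Module.Finite ℝ (LocalAlgebra f g p) ∧
      (∀ᶠ y in 𝓝 (chartPoint p), eval y (dehomogenize (chartIndex p) f) = 0 →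
        eval y (dehomogenize (chartIndex p) g) = 0 → y = chartPoint p) ∧
      Even (intersectionMultiplicity f g p) := by
  have hf0 : f ≠ 0 := by rintro rfl; exact hyp.1 (map_zero _)
  have hi := rep_chartIndex_ne_zero p
  set i := chartIndex p
  have ha : eval (chartPoint p) (dehomogenize i f) = 0 := by
    rw [chartPoint, eval_dehomogenize_affinePoint hf hi, hp, mul_zero]
  have hlift (y : Fin 2 → ℝ) : liftPoint i y ≠ 0 := fun h0 => by
    simpa using congrFun h0 i
  have hD : eval (liftPoint i (chartPoint p)) (dirDeriv e f) ≠ 0 :=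
    dirDeriv_ne_zero_of_isSmoothCurve hf hyp hs (hlift _) (by rwa [← eval_dehomogenize])
  have hτ := hD
  rw [← eval_dirDeriv_dehomogenize hf e ha] at hτ
  obtain ⟨h1, h2, h3⟩ := intersection_at_regular_point ha hτ
    (mul_dehomogenize_ne hf hg.1 (by omega) (ne_zero_of_mem_interlacerCone hg)
      (hs.irreducible hd hf hf0) ha)
  -- Near the point `D_e f` keeps its sign, so the constant `f(e) · D_e f` frozen there may replace
  -- the varying factor in the sign condition.
  refine ⟨h1, h2, h3 (eval e f * eval (liftPoint i (chartPoint p)) (dirDeriv e f))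
    (mul_ne_zero hyp.1 hD) ?_⟩
  rw [← eval_dehomogenize] at hD ⊢
  filter_upwards [(((continuous_eval (dehomogenize i (dirDeriv e f))).mul
    continuous_const).tendsto (chartPoint p)).eventually (lt_mem_nhds (mul_self_pos.2 hD))]
    with y hy hFy
  replace hy : 0 < eval y (dehomogenize i (dirDeriv e f)) *
    eval (chartPoint p) (dehomogenize i (dirDeriv e f)) := hy
  rw [eval_dehomogenize] at hFy
  have h4 := interlacerCone_nonneg hf hyp hg hFy
  rw [← eval_dehomogenize, ← eval_dehomogenize] at h4
  have hne := left_ne_zero_of_mul hy.ne'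
  refine nonneg_of_mul_nonneg_left (b := eval y (dehomogenize i (dirDeriv e f)) ^ 2) ?_
    (by positivity)
  have h5 := mul_nonneg h4 hy.le
  linarith

theorem exists_smul_mem_sphere {x : Fin 3 → ℝ} (hx : x ≠ 0) :
    ∃ c : ℝ, 0 < c ∧ c • x ∈ Metric.sphere (0 : Fin 3 → ℝ) 1 := by
  have : 0 < ‖x‖ := norm_pos_iff.2 hx
  refine ⟨‖x‖⁻¹, by positivity, ?_⟩
  rw [mem_sphere_zero_iff_norm, norm_smul, norm_inv, norm_norm, inv_mul_cancel₀ this.ne']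

theorem exists_rep_eq_smul {x : Fin 3 → ℝ} (hx : x ≠ 0) :
    ∃ c : ℝ, c ≠ 0 ∧ (Projectivization.mk ℝ x hx).rep = c • x := by
  obtain ⟨c, hc⟩ := Projectivization.exists_smul_eq_mk_rep ℝ x hx
  exact ⟨c, c.ne_zero, hc.symm⟩

theorem chartPoint_mk {x : Fin 3 → ℝ} (hx : x ≠ 0) :
    x (chartIndex (Projectivization.mk ℝ x hx)) ≠ 0 ∧
      chartPoint (Projectivization.mk ℝ x hx) =
        affinePoint (chartIndex (Projectivization.mk ℝ x hx)) x := by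
  obtain ⟨c, hc, hrep⟩ := exists_rep_eq_smul hx
  have h := rep_chartIndex_ne_zero (Projectivization.mk ℝ x hx)
  rw [chartPoint, hrep, affinePoint_smul _ hc]
  rw [hrep] at h
  exact ⟨right_ne_zero_of_mul h, rfl⟩

/-- Common zeros on the unit sphere form a compact set, and near each one every common zero is
proportional to it; a finite subcover leaves finitely many projective points. -/
theorem finite_common_zeros (hd : 1 ≤ d) (hf : f.IsHomogeneous d) (hyp : IsHyperbolic f e)
    (hs : IsSmoothCurve f) (hg : g ∈ interlacerCone d f e) :
    {p : Projectivization ℝ (Fin 3 → ℝ) | eval p.rep f = 0 ∧ eval p.rep g = 0}.Finite := by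
  set S : Set (Fin 3 → ℝ) := Metric.sphere 0 1 ∩ {y | eval y f = 0 ∧ eval y g = 0} with hS
  have hScpt : IsCompact S := (isCompact_sphere 0 1).inter_right
    ((isClosed_eq (continuous_eval f) continuous_const).inter
      (isClosed_eq (continuous_eval g) continuous_const))
  set U : (Fin 3 → ℝ) → Set (Fin 3 → ℝ) := fun x =>
    {y | eval y f = 0 → eval y g = 0 → ∃ c : ℝ, y = c • x} with hU
  have hU' : ∀ x ∈ S, U x ∈ 𝓝 x := by
    intro x hx
    have hx0 : x ≠ 0 := ne_zero_of_mem_unit_sphere ⟨x, hx.1⟩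
    obtain ⟨hxi, hcp⟩ := chartPoint_mk hx0
    obtain ⟨c, hc, hrep⟩ := exists_rep_eq_smul hx0
    have hloc := (intersection_of_mem_interlacerCone hd hf hyp hs hg
      (p := Projectivization.mk ℝ x hx0)
      (by rw [hrep, eval_smul_of_isHomogeneous hf, hx.2.1, mul_zero])).2.1
    set i := chartIndex (Projectivization.mk ℝ x hx0)
    rw [hcp] at hloc
    filter_upwards [(tendsto_affinePoint hxi).eventually hloc,
      (continuous_apply i).continuousAt.eventually_ne hxi] with y hy hyi hfy hgy
    rw [eval_dehomogenize_affinePoint hf hyi, eval_dehomogenize_affinePoint hg.1 hyi, hfy, hgy,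
      mul_zero, mul_zero] at hy
    have h1 := congrArg (liftPoint i) (hy rfl rfl)
    rw [liftPoint_affinePoint hyi, liftPoint_affinePoint hxi] at h1
    refine ⟨y i * (x i)⁻¹, ?_⟩
    rw [mul_smul, ← h1, smul_smul, mul_inv_cancel₀ hyi, one_smul]
  obtain ⟨t, htS, ht⟩ := hScpt.elim_nhds_subcover U hU'
  set Φ : (Fin 3 → ℝ) → Set (Projectivization ℝ (Fin 3 → ℝ)) :=
    fun x => {p | ∃ hx : x ≠ 0, p = Projectivization.mk ℝ x hx} with hΦ
  refine (t.finite_toSet.biUnion (t := Φ) fun x _ => ?_).subset ?_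
  · exact Set.Subsingleton.finite fun p ⟨_, hp⟩ q ⟨_, hq⟩ => by rw [hp, hq]
  · rintro p ⟨hpf, hpg⟩
    obtain ⟨c, hc, hcs⟩ := exists_smul_mem_sphere p.rep_nonzero
    have hmem : c • p.rep ∈ S := ⟨hcs, by rw [eval_smul_of_isHomogeneous hf, hpf, mul_zero],
      by rw [eval_smul_of_isHomogeneous hg.1, hpg, mul_zero]⟩
    obtain ⟨x, hxt, hx⟩ := Set.mem_iUnion₂.1 (ht hmem)
    obtain ⟨b, hb⟩ := hx hmem.2.1 hmem.2.2
    refine Set.mem_iUnion₂.2 ⟨x, hxt, ne_zero_of_mem_unit_sphere ⟨x, (htS x hxt).1⟩, ?_⟩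
    conv_lhs => rw [← p.mk_rep]
    rw [Projectivization.mk_eq_mk_iff']
    refine ⟨c⁻¹ * b, ?_⟩
    rw [mul_smul, ← hb, smul_smul, inv_mul_cancel₀ hc.ne', one_smul]

theorem realContactPoints_eq (hd : 1 ≤ d) (hf : f.IsHomogeneous d) (hyp : IsHyperbolic f e)
    (hs : IsSmoothCurve f) (hg : g ∈ interlacerCone d f e) :
    realContactPoints f g = {p | eval p.rep f = 0 ∧ eval p.rep g = 0} := by
  ext p
  exact ⟨fun h => ⟨h.1, h.2.1⟩, fun h =>
    ⟨h.1, h.2, (intersection_of_mem_interlacerCone hd hf hyp hs hg h.1).2.2⟩⟩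

/-- Where `g ≠ 0` the quotient `h/g` is locally bounded, so a bound near the common zeros suffices
on the compact sphere. Equal degrees make the inequality invariant under scaling. -/
theorem exists_bound_of_locally_bounded {k : ℕ} (hf : f.IsHomogeneous d) (hg : g.IsHomogeneous k)
    (hh : h.IsHomogeneous k)
    (hloc : ∀ x : Fin 3 → ℝ, x ≠ 0 → eval x f = 0 → eval x g = 0 →
      ∃ C : ℝ, ∀ᶠ y in 𝓝 x, eval y f = 0 → |eval y h| ≤ C * |eval y g|) :
    ∃ C : ℝ, ∀ x : Fin 3 → ℝ, x ≠ 0 → eval x f = 0 → |eval x h| ≤ C * |eval x g| := by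
  have hcpt := isCompact_sphere (0 : Fin 3 → ℝ) 1
  obtain ⟨C, hC⟩ := hcpt.induction_on
    (p := fun s => ∃ C : ℝ, ∀ y ∈ s, eval y f = 0 → |eval y h| ≤ C * |eval y g|)
    ⟨0, by simp⟩ (fun s t hst ⟨C, hC⟩ => ⟨C, fun y hy => hC y (hst hy)⟩)
    (fun s t ⟨C, hC⟩ ⟨D, hD⟩ => ⟨max C D, fun y hy hfy => by
      rcases hy with hy | hy
      · exact (hC y hy hfy).trans
          (mul_le_mul_of_nonneg_right (le_max_left _ _) (abs_nonneg _))
      · exact (hD y hy hfy).trans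
          (mul_le_mul_of_nonneg_right (le_max_right _ _) (abs_nonneg _))⟩)
    (fun x hx => by
      have hx0 : x ≠ 0 := ne_zero_of_mem_unit_sphere ⟨x, hx⟩
      suffices hsuff : ∃ C : ℝ, ∀ᶠ y in 𝓝 x, eval y f = 0 → |eval y h| ≤ C * |eval y g| by
        obtain ⟨C, hC⟩ := hsuff
        exact ⟨_, mem_nhdsWithin_of_mem_nhds hC, C, fun y hy => hy⟩
      by_cases hgx : eval x g = 0
      · by_cases hfx : eval x f = 0
        · exact hloc x hx0 hfx hgx
        · refine ⟨0, ?_⟩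
          filter_upwards [(continuous_eval f).continuousAt.eventually_ne hfx] with y hy hy0
          exact absurd hy0 hy
      · have hcont : ContinuousAt (fun y => |eval y h / eval y g|) x :=
          ((continuous_eval h).continuousAt.div (continuous_eval g).continuousAt hgx).abs
        refine ⟨|eval x h / eval x g| + 1, ?_⟩
        filter_upwards [hcont.eventually (gt_mem_nhds (lt_add_one _)),
          (continuous_eval g).continuousAt.eventually_ne hgx] with y hy hgy _
        rw [abs_div, div_lt_iff₀ (abs_pos.2 hgy)] at hy
        exact hy.le)
  refine ⟨C, fun x hx hfx => ?_⟩
  obtain ⟨c, hc, hcs⟩ := exists_smul_mem_sphere hx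
  have h1 := hC _ hcs (by rw [eval_smul_of_isHomogeneous hf, hfx, mul_zero])
  rw [eval_smul_of_isHomogeneous hg, eval_smul_of_isHomogeneous hh, abs_mul, abs_mul] at h1
  have h2 : 0 < |c ^ k| := abs_pos.2 (pow_ne_zero k hc.ne')
  refine le_of_mul_le_mul_left ?_ h2
  linarith

theorem exists_bound_of_toLocalAlgebra_eq_zero (hf : f.IsHomogeneous d) {k : ℕ}
    (hg : g.IsHomogeneous k) (hh : h.IsHomogeneous k)
    (hker : ∀ p : Projectivization ℝ (Fin 3 → ℝ), eval p.rep f = 0 → eval p.rep g = 0 →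
      toLocalAlgebra f g p h = 0) :
    ∃ C : ℝ, ∀ x : Fin 3 → ℝ, x ≠ 0 → eval x f = 0 → |eval x h| ≤ C * |eval x g| := by
  refine exists_bound_of_locally_bounded hf hg hh fun x hx0 hfx hgx => ?_
  obtain ⟨hxi, hcp⟩ := chartPoint_mk hx0
  obtain ⟨c, hc, hrep⟩ := exists_rep_eq_smul hx0
  obtain ⟨C, hC⟩ := eventually_abs_eval_le_of_mem (mem_localIdeal_of_toLocalAlgebra_eq_zero
    (hker (Projectivization.mk ℝ x hx0)
      (by rw [hrep, eval_smul_of_isHomogeneous hf, hfx, mul_zero])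
      (by rw [hrep, eval_smul_of_isHomogeneous hg, hgx, mul_zero])))
  set i := chartIndex (Projectivization.mk ℝ x hx0)
  rw [hcp] at hC
  refine ⟨C, ?_⟩
  filter_upwards [(tendsto_affinePoint hxi).eventually hC,
    (continuous_apply i).continuousAt.eventually_ne hxi] with y hy hyi hfy
  rw [eval_dehomogenize_affinePoint hf hyi, eval_dehomogenize_affinePoint hg hyi,
    eval_dehomogenize_affinePoint hh hyi, hfy, mul_zero, abs_mul, abs_mul] at hy
  have h2 : 0 < |(y i)⁻¹ ^ k| := abs_pos.2 (pow_ne_zero k (inv_ne_zero hyi))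
  refine le_of_mul_le_mul_left ?_ h2
  have := hy rfl
  linarith

/-- Adding to an interlacer a small multiple of a form dominated by it on the curve gives an
interlacer. -/
theorem add_smul_mem_interlacerCone (hd : 1 ≤ d) (hf : f.IsHomogeneous d) (hyp : IsHyperbolic f e)
    (hs : IsSmoothCurve f) (hg : g ∈ interlacerCone d f e) (hh : h.IsHomogeneous (d - 1)) {ε : ℝ}
    (hε : ∀ x : Fin 3 → ℝ, x ≠ 0 → eval x f = 0 → |ε * eval x h| ≤ |eval x g|)
    (hεe : |ε * eval e h| < eval e g) : g + ε • h ∈ interlacerCone d f e := by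
  refine mem_interlacerCone_of_nonneg hd hf hyp hs ?_ ?_ fun p hp0 hp => ?_
  · rw [smul_eq_C_mul]
    exact hg.1.add (hh.C_mul ε)
  · rw [map_add, smul_eval]
    linarith [neg_abs_le (ε * eval e h)]
  · have h1 := interlacerCone_nonneg hf hyp hg hp
    have h2 := hε p hp0 hp
    rw [map_add, smul_eval, mul_add]
    generalize eval e f * eval p (dirDeriv e f) = c at *
    have h3 : |c * (ε * eval p h)| ≤ c * eval p g := by
      rw [← abs_of_nonneg h1, abs_mul, abs_mul c]
      exact mul_le_mul_of_nonneg_left h2 (abs_nonneg c)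
    linarith [neg_abs_le (c * (ε * eval p h))]

/-- A form vanishing to at least the same order as an extremal interlacer along the curve is a
multiple of it. -/
theorem IsExtremalInterlacer.eq_smul (hd : 1 ≤ d) (hf : f.IsHomogeneous d)
    (hyp : IsHyperbolic f e) (hs : IsSmoothCurve f) (hg : IsExtremalInterlacer d f e g)
    (hh : h.IsHomogeneous (d - 1)) {C : ℝ}
    (hC : ∀ x : Fin 3 → ℝ, x ≠ 0 → eval x f = 0 → |eval x h| ≤ C * |eval x g|) :
    ∃ c : ℝ, h = c • g := by
  obtain ⟨hgc, hext⟩ := hg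
  have hge := hgc.2.2
  obtain ⟨ε, hε, hεC, hεe⟩ : ∃ ε : ℝ, 0 < ε ∧ ε * |C| ≤ 1 ∧ ε * |eval e h| < eval e g := by
    refine ⟨min (|C| + 1)⁻¹ (eval e g / (|eval e h| + 1)), by positivity, ?_, ?_⟩
    · calc _ ≤ (|C| + 1)⁻¹ * |C| := by gcongr; exact min_le_left _ _
        _ ≤ (|C| + 1)⁻¹ * (|C| + 1) := by gcongr; linarith
        _ = 1 := inv_mul_cancel₀ (by positivity)
    · calc _ ≤ eval e g / (|eval e h| + 1) * |eval e h| := by gcongr; exact min_le_right _ _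
        _ < eval e g / (|eval e h| + 1) * (|eval e h| + 1) := by gcongr; linarith
        _ = eval e g := div_mul_cancel₀ _ (by positivity)
  have hdom (x : Fin 3 → ℝ) (hx : x ≠ 0) (hfx : eval x f = 0) :
      ε * |eval x h| ≤ |eval x g| := by
    calc ε * |eval x h| ≤ ε * (C * |eval x g|) := by gcongr; exact hC x hx hfx
      _ ≤ ε * (|C| * |eval x g|) := by gcongr; exact le_abs_self C
      _ = (ε * |C|) * |eval x g| := by ring
      _ ≤ 1 * |eval x g| := by gcongr
      _ = _ := one_mul _
  have h1 := add_smul_mem_interlacerCone (ε := ε) hd hf hyp hs hgc hh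
    (fun x hx hfx => by rw [abs_mul, abs_of_pos hε]; exact hdom x hx hfx)
    (by rwa [abs_mul, abs_of_pos hε])
  have h2 := add_smul_mem_interlacerCone (ε := -ε) hd hf hyp hs hgc hh
    (fun x hx hfx => by rw [abs_mul, abs_neg, abs_of_pos hε]; exact hdom x hx hfx)
    (by rwa [abs_mul, abs_neg, abs_of_pos hε])
  -- `g` is the midpoint of `g + εh` and `g - εh`, so extremality puts `g + εh` on the ray of `g`.
  obtain ⟨c, -, hc⟩ := hext.left_mem_of_mem_openSegment h1 h2
    (⟨1, one_pos, (one_smul ℝ g).symm⟩ : g ∈ {h | ∃ c : ℝ, 0 < c ∧ h = c • g})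
    ⟨1 / 2, 1 / 2, by norm_num, by norm_num, by norm_num, by module⟩
  refine ⟨ε⁻¹ * (c - 1), ?_⟩
  rw [mul_smul, sub_smul, ← hc, one_smul, add_sub_cancel_left, smul_smul, inv_mul_cancel₀ hε.ne',
    one_smul]

end Interlacer

end

/-! ### The dimension count -/

theorem lemma1p3 (d : ℕ) (hd : 1 ≤ d) (f : MvPolynomial (Fin 3) ℝ) (hf : f.IsHomogeneous d)
    (e : Fin 3 → ℝ) (hyp : IsHyperbolic f e) (hsmooth : IsSmoothCurve f)
    (g : MvPolynomial (Fin 3) ℝ) (hg : IsExtremalInterlacer d f e g) :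
    (realContactPoints f g).Finite ∧
      ⌈(((d : ℝ) + 1) * d - 2) / 4⌉₊ ≤ realContactCount f g := by
  have hZ := realContactPoints_eq hd hf hyp hsmooth hg.1
  have hfin : (realContactPoints f g).Finite := by
    rw [hZ]; exact finite_common_zeros hd hf hyp hsmooth hg.1
  refine ⟨hfin, ?_⟩
  set Z := realContactPoints f g with hZdef
  have : Fintype Z := hfin.fintype
  -- Since `finrank` is `0` on an infinite-dimensional space, finiteness is essential for the
  -- multiplicities to bound the rank of `T`.
  have hlocfin (p : Z) : Module.Finite ℝ (LocalAlgebra f g p.1) :=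
    (intersection_of_mem_interlacerCone hd hf hyp hsmooth hg.1 p.2.1).1
  obtain ⟨hVfin, hVdim⟩ := le_finrank_homogeneousSubmodule ℝ (d - 1)
  set V := homogeneousSubmodule (Fin 3) ℝ (d - 1) with hV
  let T : V →ₗ[ℝ] ((p : Z) → LocalAlgebra f g p.1) :=
    LinearMap.pi fun p => (toLocalAlgebra f g p.1).comp V.subtype
  have hker : Module.finrank ℝ (LinearMap.ker T) ≤ 1 := by
    have hgT : T ⟨g, hg.1.1⟩ = 0 := by
      ext p
      change toLocalAlgebra f g p.1 g = 0
      refine Ideal.Quotient.eq_zero_iff_mem.2 (Ideal.mem_map_of_mem _ (Ideal.subset_span ?_))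
      exact Set.mem_insert_of_mem _ rfl
    refine finrank_le_one (⟨⟨g, hg.1.1⟩, hgT⟩ : LinearMap.ker T) ?_
    rintro ⟨⟨h, hh⟩, hT⟩
    obtain ⟨C, hC⟩ := exists_bound_of_toLocalAlgebra_eq_zero hf hg.1.1 hh fun p hpf hpg => by
      have hpZ : p ∈ Z := by rw [hZ]; exact ⟨hpf, hpg⟩
      exact congrFun (LinearMap.mem_ker.1 hT) ⟨p, hpZ⟩
    obtain ⟨c, hc⟩ := hg.eq_smul hd hf hyp hsmooth hh hC
    exact ⟨c, Subtype.ext (Subtype.ext hc.symm)⟩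
  have hrange := LinearMap.finrank_range_add_finrank_ker T
  have hrange' : Module.finrank ℝ (LinearMap.range T) ≤
      ∑ p : Z, intersectionMultiplicity f g p.1 := by
    refine (Submodule.finrank_le _).trans_eq ?_
    rw [Module.finrank_pi_fintype]
    rfl
  have hcount : ∑ p : Z, intersectionMultiplicity f g p.1 = 2 * realContactCount f g := by
    rw [realContactCount, finsum_mem_eq_finite_toFinset_sum _ hfin, Finset.mul_sum,
      ← Finset.sum_subtype hfin.toFinset (fun p => hfin.mem_toFinset)
        (fun p => intersectionMultiplicity f g p)]
    exact Finset.sum_congr rfl fun p hp =>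
      (Nat.two_mul_div_two_of_even (hfin.mem_toFinset.1 hp).2.2).symm
  obtain ⟨n, rfl⟩ : ∃ n, d = n + 1 := ⟨d - 1, by omega⟩
  rw [Nat.add_sub_cancel] at hVdim
  -- Rank–nullity with kernel at most one gives `dim V ≤ 2N + 1`, doubled here to avoid division;
  -- recall `d = n + 1`.
  have hmain : (n + 2) * (n + 1) ≤ 4 * realContactCount f g + 2 := by omega
  rw [Nat.ceil_le, div_le_iff₀ (by norm_num)]
  have hmain' : ((n : ℝ) + 2) * (n + 1) ≤ 4 * realContactCount f g + 2 := by exact_mod_cast hmain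
  push_cast
  linarith
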